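/- Let $(\Omega,\mathcal F,\mathbb P)$ be a probability space carrying three independent random elements: an iid sequence $Z=(Z_i)_{i\ge 1}$ of claim sizes, $Z_1\sim\mathrm{Exp}(b)$; an iid sequence $Y=(Y_i)_{i\ge1}$ of premium sizes, $Y_1\sim\mathrm{Exp}(a)$, where $a,b\in(0,\infty)$ are rates (so that $\mathbb E Y_1=1/a$, $\mathbb E Z_1=1/b$); and a quadruplet $(M,L,\Delta,\Gamma)$, where $\Delta,\Gamma$ are $(0,\infty)$-valued random variables and $M=(M_t)_{t\ge0}$, $L=(L_t)_{t\ge 0}$ are, conditionally on $(\Delta,\Gamma)$, independent homogeneous Poisson processes with intensities $\Delta$ and $\Gamma$, respectively. For an initial capital $u\in[0,\infty)$ and a premium rate $c\in[0,\infty)$ let $$K_t:=u+ct+\sum_{i=1}^{M_t}Y_i-\sum_{i=1}^{L_t}Z_i,\qquad t\in[0,\infty),$$ and let $\psi(u):=\mathbb P\big(\inf_{t\in[0,\infty)}K_t<0\big)$ be the ruin probability (the event is measurable up to null sets). (i) Suppose $c>0$. For $\gamma,\delta\in(0,\infty)$ put $$r^{\gamma,\delta}:=\frac{c(b-a)-\delta-\gamma+\sqrt{((a+b)c+\delta)^2-2((a+b)c-\delta)\gamma+\gamma^2}}{2c}.$$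 If $\gamma/b-\delta/a<c$, then $r^{\gamma,\delta}$ is the unique root in $(0,b)$ of the adjustment equation $c+\frac{\delta}{a+r}=\frac{\gamma}{b-r}$. Moreover $$\psi(u)=\int_{(0,\infty)^2}\Big(1-\frac{r^{\gamma,\delta}}{b}\Big)e^{-r^{\gamma,\delta}u}\,\mathbb 1_{(-\infty,c)}\Big(\frac{\gamma}{b}-\frac{\delta}{a}\Big)\,\mathbb P_{(\Gamma,\Delta)}(d\gamma,d\delta)+\mathbb P\Big(\frac{\Gamma}{b}-\frac{\Delta}{a}\ge c\Big),$$ where $\mathbb P_{(\Gamma,\Delta)}$ is the law of $(\Gamma,\Delta)$ and the integrand is integrable. (ii) Suppose $c=0$. For $\gamma,\delta\in(0,\infty)$ with $\gamma/b-\delta/a<0$, the unique root in $(0,b)$ of the adjustment equation $\frac{\delta}{a+r}=\frac{\gamma}{b-r}$ is $\frac{b\delta-a\gamma}{\delta+\gamma}$. Moreover $$\psi(u)=\int_{(0,\infty)^2}\frac{1+a/b}{1+\delta/\gamma}\,e^{-\frac{b\delta-a\gamma}{\delta+\gamma}u}\,\mathbb 1_{(-\infty,0)}\Big(\frac{\gamma}{b}-\frac{\delta}{a}\Big)\,\mathbb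 P_{(\Gamma,\Delta)}(d\gamma,d\delta)+\mathbb P\Big(\frac{\Gamma}{b}-\frac{\Delta}{a}\ge 0\Big),$$ where the integrand is integrable. -/

import Mathlib

open MeasureTheory ProbabilityTheory Set
open scoped NNReal

noncomputable section

namespace RuinModel

variable {Ω : Type*} [MeasurableSpace Ω]

/-- The paths of `N` almost surely start at `0`, are nondecreasing and right-continuous. -/
def HasCountingPaths (P : Measure Ω) (N : ℝ≥0 → Ω → ℕ) : Prop :=
  ∀ᵐ ω ∂P, N 0 ω = 0 ∧ Monotone (fun t => N t ω) ∧
    ∀ t, ContinuousWithinAt (fun s => N s ω) (Ici t) t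

/-- The weight `e^{-x} x^k / k!` that the Poisson law with mean `x` gives to `k`. -/
def poissonWeight (x : ℝ) (k : ℕ) : ℝ := Real.exp (-x) * x ^ k / (k.factorial : ℝ)

/-- Conditionally on `(Δ, Γ)`, `M` and `L` are independent homogeneous Poisson processes with
intensities `Δ` and `Γ`: both are counting processes and, given `(Δ, Γ)`, all the increments of `M`
and of `L` over the consecutive intervals of any finite time grid are independent and Poisson
distributed, with means `Δ` (respectively `Γ`) times the lengths of the intervals. -/
structure IsCondPoissonPair (P : Measure Ω) (M L : ℝ≥0 → Ω → ℕ) (Δ Γ : Ω → ℝ) : Prop where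
  measurable_M : ∀ t, Measurable (M t)
  measurable_L : ∀ t, Measurable (L t)
  paths_M : HasCountingPaths P M
  paths_L : HasCountingPaths P L
  increments : ∀ (n : ℕ) (t : Fin (n + 1) → ℝ≥0), Monotone t → ∀ k l : Fin n → ℕ,
    P⟦{ω | ∀ i : Fin n, M (t i.succ) ω = M (t i.castSucc) ω + k i ∧
          L (t i.succ) ω = L (t i.castSucc) ω + l i} |
        MeasurableSpace.comap (fun ω => (Δ ω, Γ ω)) inferInstance⟧
      =ᵐ[P] fun ω => ∏ i : Fin n,
        (poissonWeight (Δ ω * ((t i.succ : ℝ) - t i.castSucc)) (k i) *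
          poissonWeight (Γ ω * ((t i.succ : ℝ) - t i.castSucc)) (l i))

/-- An iid sequence of positive random variables of finite mean. -/
structure IsIIDPositive (P : Measure Ω) (X : ℕ → Ω → ℝ) : Prop where
  measurable : ∀ i, Measurable (X i)
  indep : iIndepFun X P
  identDistrib : ∀ i, IdentDistrib (X i) (X 0) P P
  pos : ∀ i, ∀ᵐ ω ∂P, 0 < X i ω
  integrable : Integrable (X 0) P

/-- The model: premium sizes `Y`, claim sizes `Z`, premium and claim counting processes `M`, `L`
with random intensities `Δ`, `Γ`. The three random elements `Z`, `Y` and `(M, L, Δ, Γ)` are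
mutually independent, expressed as: `Z` is independent of `Y`, and `(Z, Y)` is independent
of `(M, L, Δ, Γ)`. -/
structure IsSurplusModel (P : Measure Ω) (Z Y : ℕ → Ω → ℝ) (M L : ℝ≥0 → Ω → ℕ)
    (Δ Γ : Ω → ℝ) : Prop where
  claims : IsIIDPositive P Z
  premiums : IsIIDPositive P Y
  measurable_Δ : Measurable Δ
  measurable_Γ : Measurable Γ
  pos_Δ : ∀ᵐ ω ∂P, 0 < Δ ω
  pos_Γ : ∀ᵐ ω ∂P, 0 < Γ ω
  arrivals : IsCondPoissonPair P M L Δ Γ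
  indep_claims_premiums : IndepFun (fun ω i => Z i ω) (fun ω i => Y i ω) P
  indep_sizes_arrivals :
    IndepFun (fun ω => ((fun i => Z i ω : ℕ → ℝ), (fun i => Y i ω : ℕ → ℝ)))
      (fun ω => ((fun t => M t ω : ℝ≥0 → ℕ), (fun t => L t ω : ℝ≥0 → ℕ), Δ ω, Γ ω)) P

/-- The surplus `K_t = u + c t + ∑_{i ≤ M_t} Y_i - ∑_{i ≤ L_t} Z_i`; the sequences are indexed
from `0`. -/
def surplus (u c : ℝ) (Z Y : ℕ → Ω → ℝ) (M L : ℝ≥0 → Ω → ℕ) (t : ℝ≥0) (ω : Ω) : ℝ :=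
  u + c * t + ∑ i ∈ Finset.range (M t ω), Y i ω - ∑ i ∈ Finset.range (L t ω), Z i ω

/-- The event of ruin `{inf_t K_t < 0}`, with the infimum in the extended reals. -/
def ruin (u c : ℝ) (Z Y : ℕ → Ω → ℝ) (M L : ℝ≥0 → Ω → ℕ) : Set Ω :=
  {ω | (⨅ t : ℝ≥0, (surplus u c Z Y M L t ω : EReal)) < 0}

/-- The ruin probability `ψ(u)`. -/
def ruinProb (P : Measure Ω) (c : ℝ) (Z Y : ℕ → Ω → ℝ) (M L : ℝ≥0 → Ω → ℕ) (u : ℝ) : ℝ :=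
  P.real (ruin u c Z Y M L)

/-- `r` is a root in `(0, b)` of the adjustment equation `c + δ / (a + r) = γ / (b - r)`. -/
def IsAdjustmentRoot (a b c γ δ r : ℝ) : Prop :=
  r ∈ Ioo 0 b ∧ c + δ / (a + r) = γ / (b - r)

/-- The explicit expression for the root `r^{γ,δ}` when `c > 0`. -/
def adjRate (a b c γ δ : ℝ) : ℝ :=
  (c * (b - a) - δ - γ +
    √(((a + b) * c + δ) ^ 2 - 2 * ((a + b) * c - δ) * γ + γ ^ 2)) / (2 * c)

/-- The integrand when `c > 0`, as a function of `(γ, δ)`. -/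
def ruinIntegrand (a b c u : ℝ) (p : ℝ × ℝ) : ℝ :=
  (1 - adjRate a b c p.1 p.2 / b) * Real.exp (-(adjRate a b c p.1 p.2) * u) *
    (Iio c).indicator 1 (p.1 / b - p.2 / a)

/-- The integrand when `c = 0`, as a function of `(γ, δ)`. -/
def ruinIntegrandZero (a b u : ℝ) (p : ℝ × ℝ) : ℝ :=
  (1 + a / b) / (1 + p.2 / p.1) * Real.exp (-((b * p.2 - a * p.1) / (p.2 + p.1)) * u) *
    (Iio 0).indicator 1 (p.1 / b - p.2 / a)

end RuinModel

end

noncomputable section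

namespace RuinModel

open Filter Topology
open scoped ENNReal

-- Given intensities `(γ, δ)` and a mesh `h`, the surplus observed on the grid is a random walk with
-- compound Poisson steps. Because the jumps are exponential, `phi b s` is, up to an error of order
-- `h ^ 2`, an eigenfunction of one step of this walk killed at ruin, with value 1 below zero
-- (`singleJumpMean_phi`). The eigenvalue is 1 to first order exactly when `s` solves the adjustment
-- equation.
--
-- Let `r` be the root. Heuristically, `phi b r x` is the probability of ruin by step `n` plus the
-- mean of `phi b r` at the position after `n` steps on survival. Hence survival plus `phi b r` is
-- at least 1. Its excess over 1 is at most the corresponding mean of `phi b s` with `s < r`, whose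
-- eigenvalue is below 1, so the excess decays geometrically. Both bounds are inductions on the
-- number of steps (`one_le_survival_add_phi`, `survival_add_phi_le`), and no law of large numbers
-- is used. With mesh `2 ^ (-m)` and horizon `m` the accumulated error is of order `m * 2 ^ (-m)`,
-- so survival tends to `1 - phi b r`. If the drift is not positive, raising `c` makes any small `r
-- > 0` a root, and `r → 0` gives survival probability 0.
--
-- For the model itself, `measure_gridSurvival` writes survival on a grid as the mean over `(Δ, Γ)`
-- of the survival of the walk. Right-continuity of the paths reduces ruin to the dyadic grids, and
-- dominated convergence gives the formula (`IsSurplusModel.ruinProb_eq`).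

-- Exponential averages of the candidate ruin function.

/-- The ruin probability of the surplus process with adjustment coefficient `s`, as a function of
the initial capital; it is `1` for negative capital. -/
def phi (b s x : ℝ) : ℝ := if 0 ≤ x then (1 - s / b) * Real.exp (-s * x) else 1

lemma phi_of_nonneg {b s x : ℝ} (hx : 0 ≤ x) : phi b s x = (1 - s / b) * Real.exp (-s * x) :=
  if_pos hx

lemma phi_of_neg {b s x : ℝ} (hx : x < 0) : phi b s x = 1 := if_neg hx.not_ge

lemma measurable_phi (b s : ℝ) : Measurable (phi b s) := by
  unfold phi
  exact Measurable.ite measurableSet_Ici (by fun_prop) measurable_const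

lemma phi_nonneg {b s : ℝ} (hb : 0 < b) (hsb : s < b) (x : ℝ) : 0 ≤ phi b s x := by
  unfold phi
  have : 0 ≤ 1 - s / b := sub_nonneg.2 ((div_le_one hb).2 hsb.le)
  split_ifs <;> positivity

lemma phi_le_of_le {b r s : ℝ} (hb : 0 < b) (hsb : s < b) (hsr : s ≤ r) (x : ℝ) :
    phi b r x ≤ phi b s x := by
  unfold phi
  have : 0 ≤ 1 - s / b := sub_nonneg.2 ((div_le_one hb).2 hsb.le)
  split_ifs with hx
  · gcongr
  · exact le_rfl

/-- Comparison with the parameter 0, since `phi b 0` is identically 1. -/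
lemma phi_le_one {b s : ℝ} (hb : 0 < b) (hs : 0 ≤ s) (x : ℝ) : phi b s x ≤ 1 := by
  refine (phi_le_of_le hb hb hs x).trans ?_
  unfold phi
  split_ifs <;> simp

lemma phi_add {b s x d : ℝ} (hx : 0 ≤ x) (hd : 0 ≤ d) :
    phi b s (x + d) = phi b s x * Real.exp (-s * d) := by
  rw [phi_of_nonneg hx, phi_of_nonneg (add_nonneg hx hd), mul_assoc, ← Real.exp_add]
  ring_nf

lemma measurable_exponentialPDF (r : ℝ) : Measurable (exponentialPDF r) :=
  (measurable_exponentialPDFReal r).ennreal_ofReal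

lemma lintegral_expMeasure {a : ℝ} {f : ℝ → ℝ≥0∞} (hf : Measurable f) :
    ∫⁻ t, f t ∂expMeasure a = ∫⁻ t, exponentialPDF a t * f t := by
  rw [expMeasure, gammaMeasure]
  exact lintegral_withDensity_eq_lintegral_mul _
    (measurable_exponentialPDF a) hf

/-- An exponential tilt of an exponential density is a multiple of an exponential density. -/
lemma exponentialPDF_mul_exp {a s t : ℝ} (ha : 0 < a) (has : 0 < a + s) :
    exponentialPDF a t * ENNReal.ofReal (Real.exp (-s * t)) =
      ENNReal.ofReal (a / (a + s)) * exponentialPDF (a + s) t := by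
  rcases lt_or_ge t 0 with ht | ht
  · simp [exponentialPDF_of_neg ht]
  · rw [exponentialPDF_of_nonneg ht, exponentialPDF_of_nonneg ht,
      ← ENNReal.ofReal_mul (by positivity), ← ENNReal.ofReal_mul (by positivity)]
    congr 1
    rw [mul_assoc, ← Real.exp_add]
    field_simp
    ring_nf

/-- A premium keeps the capital nonnegative, so only the Laplace transform of its law enters. -/
lemma lintegral_phi_add {a b s y : ℝ} (ha : 0 < a) (hb : 0 < b) (hs : 0 ≤ s) (hsb : s < b)
    (hy : 0 ≤ y) :
    ∫⁻ t, ENNReal.ofReal (phi b s (y + t)) ∂expMeasure a =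
      ENNReal.ofReal (phi b s y * (a / (a + s))) := by
  have hm := measurable_phi b s
  rw [lintegral_expMeasure (by fun_prop)]
  have h : ∀ t, exponentialPDF a t * ENNReal.ofReal (phi b s (y + t)) =
      ENNReal.ofReal (phi b s y) * ENNReal.ofReal (a / (a + s)) * exponentialPDF (a + s) t := by
    intro t
    rcases lt_or_ge t 0 with ht | ht
    · simp [exponentialPDF_of_neg ht]
    · rw [phi_add hy ht, ENNReal.ofReal_mul (phi_nonneg hb hsb y), mul_left_comm,
        exponentialPDF_mul_exp ha (by positivity), mul_assoc]
  simp_rw [h]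
  rw [lintegral_const_mul _ (measurable_exponentialPDF _),
    lintegral_exponentialPDF_eq_one (by positivity), mul_one,
    ENNReal.ofReal_mul (phi_nonneg hb hsb y)]

/-- This is where the prefactor `1 - s / b` is forced. Claims up to `y` contribute `e^{-sy} -
e^{-by}`, claims beyond `y` cause ruin and contribute `e^{-by}`, and the boundary terms cancel. -/
lemma lintegral_phi_sub {b s y : ℝ} (hb : 0 < b) (hsb : s < b) (hy : 0 ≤ y) :
    ∫⁻ t, ENNReal.ofReal (phi b s (y - t)) ∂expMeasure b =
      ENNReal.ofReal (phi b s y * (b / (b - s))) := by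
  have hm := measurable_phi b s
  have hbs : 0 < b + -s := by linarith
  have hA : 0 ≤ 1 - s / b := sub_nonneg.2 ((div_le_one hb).2 hsb.le)
  rw [lintegral_expMeasure (by fun_prop), ← lintegral_add_compl _ (measurableSet_Iic (a := y))]
  have h1 : ∫⁻ t in Iic y, exponentialPDF b t * ENNReal.ofReal (phi b s (y - t)) =
      ENNReal.ofReal (Real.exp (-s * y) - Real.exp (-b * y)) := by
    have : ∫⁻ t in Iic y, exponentialPDF b t * ENNReal.ofReal (phi b s (y - t)) =
        ∫⁻ t in Iic y, ENNReal.ofReal (Real.exp (-s * y)) * exponentialPDF (b + -s) t := by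
      refine setLIntegral_congr_fun measurableSet_Iic fun t (ht : t ≤ y) => ?_
      have e : phi b s (y - t) =
          (1 - s / b) * Real.exp (-s * y) * Real.exp (- -s * t) := by
        rw [phi_of_nonneg (sub_nonneg.2 ht), mul_assoc, ← Real.exp_add]
        ring_nf
      rw [e, ENNReal.ofReal_mul (by positivity), mul_left_comm, exponentialPDF_mul_exp hb hbs,
        ← mul_assoc, ← ENNReal.ofReal_mul (by positivity)]
      congr 2
      field_simp
      ring
    rw [this, lintegral_const_mul _ (measurable_exponentialPDF _),
      lintegral_exponentialPDF_eq_antiDeriv hbs, if_pos hy, ← ENNReal.ofReal_mul (by positivity), mul_sub, mul_one, ← Real.exp_add]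
    ring_nf
  have h2 : ∫⁻ t in (Iic y)ᶜ, exponentialPDF b t * ENNReal.ofReal (phi b s (y - t)) =
      ENNReal.ofReal (Real.exp (-b * y)) := by
    have : ∫⁻ t in (Iic y)ᶜ, exponentialPDF b t * ENNReal.ofReal (phi b s (y - t)) =
        ∫⁻ t in (Iic y)ᶜ, exponentialPDF b t := by
      refine setLIntegral_congr_fun measurableSet_Iic.compl fun t ht => ?_
      have ht' : y - t < 0 := by simpa using ht
      simp [phi_of_neg ht']
    rw [this]
    have htot := lintegral_add_compl (μ := volume) (exponentialPDF b) (measurableSet_Iic (a := y))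
    rw [lintegral_exponentialPDF_eq_antiDeriv hb, if_pos hy,
      lintegral_exponentialPDF_eq_one hb] at htot
    have hle : Real.exp (-b * y) ≤ 1 := Real.exp_le_one_iff.2 (by nlinarith)
    rw [add_comm] at htot
    rw [ENNReal.eq_sub_of_add_eq ENNReal.ofReal_ne_top htot,
      ← ENNReal.ofReal_one, ← ENNReal.ofReal_sub _ (by
        rw [sub_nonneg]; simpa only [neg_mul] using hle)]
    congr 1
    ring_nf
  have hle : Real.exp (-b * y) ≤ Real.exp (-s * y) := Real.exp_le_exp.2 (by nlinarith)
  rw [h1, h2, ← ENNReal.ofReal_add (sub_nonneg.2 hle) (by positivity), phi_of_nonneg hy]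
  congr 1
  have : b - s ≠ 0 := by linarith
  field_simp
  ring

-- Compound Poisson steps and the survival of the random walk.

/-- The law of a sequence of independent variables of law `ρ`. -/
abbrev seqLaw (ρ : Measure ℝ) [IsProbabilityMeasure ρ] : Measure (ℕ → ℝ) :=
  Measure.infinitePi fun _ => ρ

/-- The net change of the surplus by `p.1` premiums and `p.2` claims, the first ones of the
sequences `q.1` and `q.2`. -/
def blockSum (p : ℕ × ℕ) (q : (ℕ → ℝ) × (ℕ → ℝ)) : ℝ :=
  ∑ i ∈ Finset.range p.1, q.1 i - ∑ i ∈ Finset.range p.2, q.2 i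

/-- The remaining premiums and claims after `p.1` premiums and `p.2` claims. -/
def blockShift (p : ℕ × ℕ) (q : (ℕ → ℝ) × (ℕ → ℝ)) : (ℕ → ℝ) × (ℕ → ℝ) :=
  (fun i => q.1 (i + p.1), fun i => q.2 (i + p.2))

lemma measurable_blockSum (p : ℕ × ℕ) : Measurable (blockSum p) := by
  unfold blockSum
  fun_prop

lemma measurable_blockShift (p : ℕ × ℕ) : Measurable (blockShift p) := by
  unfold blockShift
  fun_prop

/-- The law of the net change of the surplus by `p.1` premiums and `p.2` claims. -/
def blockLaw (ρ σ : Measure ℝ) [IsProbabilityMeasure ρ] [IsProbabilityMeasure σ] (p : ℕ × ℕ) :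
    Measure ℝ :=
  ((seqLaw ρ).prod (seqLaw σ)).map (blockSum p)

instance (ρ σ : Measure ℝ) [IsProbabilityMeasure ρ] [IsProbabilityMeasure σ] (p : ℕ × ℕ) :
    IsProbabilityMeasure (blockLaw ρ σ p) :=
  Measure.isProbabilityMeasure_map (measurable_blockSum p).aemeasurable

/-- The probability of `p.1` premiums and `p.2` claims. -/
def countWeight (α β : ℝ) (p : ℕ × ℕ) : ℝ≥0∞ :=
  ENNReal.ofReal (poissonWeight α p.1 * poissonWeight β p.2)

/-- The law of a compound Poisson increment, with means `α` and `β` for the numbers of premiums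
and of claims. -/
def stepLaw (ρ σ : Measure ℝ) [IsProbabilityMeasure ρ] [IsProbabilityMeasure σ] (α β : ℝ) :
    Measure ℝ :=
  Measure.sum fun p => countWeight α β p • blockLaw ρ σ p

/-- The probability that a random walk with step law `π` and drift `d` started from `x` is
nonnegative at the times `0, …, n`. -/
def survival (π : Measure ℝ) (d : ℝ) : ℕ → ℝ → ℝ≥0∞
  | 0, x => if 0 ≤ x then 1 else 0
  | n + 1, x => if 0 ≤ x then ∫⁻ y, survival π d n (x + d + y) ∂π else 0

lemma survival_mono (π : Measure ℝ) {d d' : ℝ} (hd : d ≤ d') (n : ℕ) {x x' : ℝ} (hx : x ≤ x') :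
    survival π d n x ≤ survival π d' n x' := by
  induction n generalizing x x' with
  | zero =>
    simp only [survival]
    split_ifs with h h'
    · exact le_rfl
    · exact absurd (h.trans hx) h'
    · exact zero_le
    · exact le_rfl
  | succ n ih =>
    simp only [survival]
    split_ifs with h h'
    · exact lintegral_mono fun y => ih (by linarith)
    · exact absurd (h.trans hx) h'
    · exact zero_le
    · exact le_rfl

lemma survival_le_one (π : Measure ℝ) [IsProbabilityMeasure π] (d : ℝ) (n : ℕ) (x : ℝ) :
    survival π d n x ≤ 1 := by
  induction n generalizing x with
  | zero => simp only [survival]; split_ifs <;> simp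
  | succ n ih =>
    simp only [survival]
    split_ifs
    · exact (lintegral_mono fun y => ih _).trans (by simp)
    · simp

lemma poissonWeight_nonneg {x : ℝ} (hx : 0 ≤ x) (k : ℕ) : 0 ≤ poissonWeight x k := by
  unfold poissonWeight
  positivity

lemma tsum_ofReal_poissonWeight {x : ℝ} (hx : 0 ≤ x) :
    ∑' k, ENNReal.ofReal (poissonWeight x k) = 1 := by
  have h : HasSum (fun k => poissonWeight x k) 1 := by
    have := (NormedSpace.expSeries_div_hasSum_exp x).mul_left (Real.exp (-x))
    rw [← Real.exp_eq_exp_ℝ, ← Real.exp_add, neg_add_cancel, Real.exp_zero] at this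
    simpa only [poissonWeight, mul_div_assoc] using this
  rw [← ENNReal.ofReal_tsum_of_nonneg (poissonWeight_nonneg hx) h.summable, h.tsum_eq,
    ENNReal.ofReal_one]

lemma tsum_countWeight {α β : ℝ} (hα : 0 ≤ α) (hβ : 0 ≤ β) :
    ∑' p, countWeight α β p = 1 := by
  rw [ENNReal.tsum_prod']
  simp only [countWeight, ENNReal.ofReal_mul (poissonWeight_nonneg hα _), ENNReal.tsum_mul_left,
    tsum_ofReal_poissonWeight hβ, mul_one, tsum_ofReal_poissonWeight hα]

section StepLaw

variable (ρ σ : Measure ℝ) [IsProbabilityMeasure ρ] [IsProbabilityMeasure σ]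

lemma lintegral_stepLaw (α β : ℝ) (f : ℝ → ℝ≥0∞) :
    ∫⁻ y, f y ∂stepLaw ρ σ α β = ∑' p, countWeight α β p * ∫⁻ y, f y ∂blockLaw ρ σ p := by
  simp [stepLaw, lintegral_sum_measure, lintegral_smul_measure]

lemma isProbabilityMeasure_stepLaw {α β : ℝ} (hα : 0 ≤ α) (hβ : 0 ≤ β) :
    IsProbabilityMeasure (stepLaw ρ σ α β) := by
  constructor
  rw [← lintegral_one, lintegral_stepLaw]
  simp [tsum_countWeight hα hβ]

lemma blockLaw_zero_zero : blockLaw ρ σ (0, 0) = Measure.dirac 0 := by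
  have : blockSum (0, 0) = fun _ => 0 := by ext; simp [blockSum]
  rw [blockLaw, this, Measure.map_const]
  simp

lemma blockLaw_one_zero : blockLaw ρ σ (1, 0) = ρ := by
  have : blockSum (1, 0) = (fun y : ℕ → ℝ => y 0) ∘ Prod.fst := by ext; simp [blockSum]
  rw [blockLaw, this, ← Measure.map_map (by fun_prop) (by fun_prop), Measure.map_fst_prod]
  simp [Measure.infinitePi_map_eval]

lemma blockLaw_zero_one : blockLaw ρ σ (0, 1) = σ.map (fun z => -z) := by
  have : blockSum (0, 1) = (fun z : ℝ => -z) ∘ (fun y : ℕ → ℝ => y 0) ∘ Prod.snd := by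
    ext; simp [blockSum]
  rw [blockLaw, this, ← Measure.map_map (by fun_prop) (by fun_prop),
    ← Measure.map_map (by fun_prop) (by fun_prop), Measure.map_snd_prod]
  simp [Measure.infinitePi_map_eval]

/-- The contribution of at most one jump to the mean of `f` under the step law. -/
def singleJumpMean (α β : ℝ) (f : ℝ → ℝ≥0∞) : ℝ≥0∞ :=
  ENNReal.ofReal (Real.exp (-(α + β))) * (f 0 + ENNReal.ofReal α * ∫⁻ y, f y ∂ρ +
    ENNReal.ofReal β * ∫⁻ z, f (-z) ∂σ)

lemma sum_single_jump (α β : ℝ) {f : ℝ → ℝ≥0∞} (hf : Measurable f) :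
    ∑ p ∈ {(0, 0), (1, 0), (0, 1)}, countWeight α β p * ∫⁻ y, f y ∂blockLaw ρ σ p =
      singleJumpMean ρ σ α β f := by
  rw [Finset.sum_insert (by decide), Finset.sum_insert (by decide), Finset.sum_singleton,
    blockLaw_zero_zero, blockLaw_one_zero, blockLaw_zero_one, lintegral_dirac' _ hf,
    lintegral_map hf measurable_neg]
  have e : Real.exp (-(α + β)) = Real.exp (-α) * Real.exp (-β) := by
    rw [← Real.exp_add]; ring_nf
  have h0 : countWeight α β (0, 0) = ENNReal.ofReal (Real.exp (-(α + β))) := by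
    rw [e]
    simp [countWeight, poissonWeight]
  have h1 : countWeight α β (1, 0) =
      ENNReal.ofReal (Real.exp (-(α + β))) * ENNReal.ofReal α := by
    rw [← ENNReal.ofReal_mul (by positivity), e]
    simp [countWeight, poissonWeight, mul_right_comm]
  have h2 : countWeight α β (0, 1) =
      ENNReal.ofReal (Real.exp (-(α + β))) * ENNReal.ofReal β := by
    rw [← ENNReal.ofReal_mul (by positivity), e]
    simp [countWeight, poissonWeight, mul_assoc]
  rw [h0, h1, h2, singleJumpMean]
  ring

lemma singleJumpMean_le (α β : ℝ) {f : ℝ → ℝ≥0∞} (hf : Measurable f) :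
    singleJumpMean ρ σ α β f ≤ ∫⁻ y, f y ∂stepLaw ρ σ α β := by
  rw [← sum_single_jump ρ σ α β hf, lintegral_stepLaw]
  exact ENNReal.sum_le_tsum _

/-- Two or more jumps have probability at most `(α + β) ^ 2`. -/
lemma lintegral_stepLaw_le {α β : ℝ} (hα : 0 ≤ α) (hβ : 0 ≤ β) {f : ℝ → ℝ≥0∞}
    (hf : Measurable f) (hf1 : ∀ y, f y ≤ 1) :
    ∫⁻ y, f y ∂stepLaw ρ σ α β ≤ singleJumpMean ρ σ α β f + ENNReal.ofReal ((α + β) ^ 2) := by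
  -- The total weight of two or more jumps is read off from the decomposition of the constant
  -- function 1.
  have key := ENNReal.sum_add_tsum_compl {(0, 0), (1, 0), (0, 1)}
    (fun p => countWeight α β p * ∫⁻ _, 1 ∂blockLaw ρ σ p)
  rw [sum_single_jump ρ σ α β measurable_const] at key
  simp only [lintegral_const, measure_univ, mul_one, tsum_countWeight hα hβ,
    singleJumpMean] at key
  rw [lintegral_stepLaw, ← ENNReal.sum_add_tsum_compl {(0, 0), (1, 0), (0, 1)},
    sum_single_jump ρ σ α β hf]
  gcongr
  refine (ENNReal.tsum_le_tsum (g := fun p : ↥(({(0, 0), (1, 0), (0, 1)} : Finset (ℕ × ℕ)) :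
    Set (ℕ × ℕ))ᶜ => countWeight α β p) fun p => ?_).trans ?_
  · refine mul_le_of_le_one_right (zero_le) ((lintegral_mono hf1).trans ?_)
    simp
  · rw [add_comm, ← ENNReal.ofReal_one, ← ENNReal.ofReal_add zero_le_one hα,
      ← ENNReal.ofReal_add (by positivity) hβ, ← ENNReal.ofReal_mul (by positivity)] at key
    rw [ENNReal.eq_sub_of_add_eq ENNReal.ofReal_ne_top key,
      ← ENNReal.ofReal_sub _ (by positivity)]
    refine ENNReal.ofReal_le_ofReal ?_
    -- With `q = α + β`, this gives `1 - e^{-q} (1 + q) ≤ 1 - (1 - q) (1 + q) = q ^ 2`.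
    have := Real.add_one_le_exp (-(α + β))
    nlinarith [mul_le_mul_of_nonneg_right this (by positivity : 0 ≤ 1 + α + β)]

end StepLaw

-- Two-sided comparison of survival with `phi`.

section Bounds

variable {ρ σ : Measure ℝ} [IsProbabilityMeasure ρ] [IsProbabilityMeasure σ] {a b α β d : ℝ}

/-- The eigenfunction property. At a root `s = r` the eigenvalue is `e^{-q} (1 + q)` with `q = α + β
+ r d`, which lies between `1 - q ^ 2` and 1. -/
lemma singleJumpMean_phi (hρ : ρ = expMeasure a) (hσ : σ = expMeasure b) (ha : 0 < a) (hb : 0 < b)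
    (hα : 0 ≤ α) (hβ : 0 ≤ β) (hd : 0 ≤ d) {s x : ℝ} (hs : 0 ≤ s) (hsb : s < b) (hx : 0 ≤ x) :
    singleJumpMean ρ σ α β (fun y => ENNReal.ofReal (phi b s (x + d + y))) =
      ENNReal.ofReal (phi b s x * (Real.exp (-(α + β + s * d)) *
        (1 + (α * (a / (a + s)) + β * (b / (b - s)))))) := by
  subst hρ hσ
  have hxd : 0 ≤ x + d := add_nonneg hx hd
  have hp := phi_nonneg hb hsb (x + d)
  have hbs : 0 < b - s := sub_pos.2 hsb
  have e : Real.exp (-(α + β + s * d)) = Real.exp (-(α + β)) * Real.exp (-s * d) := by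
    rw [← Real.exp_add]; ring_nf
  rw [singleJumpMean, lintegral_phi_add ha hb hs hsb hxd]
  simp only [← sub_eq_add_neg]
  rw [lintegral_phi_sub hb hsb hxd, add_zero, ← ENNReal.ofReal_mul hα, ← ENNReal.ofReal_mul hβ,
    ← ENNReal.ofReal_add hp (by positivity), ← ENNReal.ofReal_add (by positivity) (by positivity),
    ← ENNReal.ofReal_mul (by positivity), phi_add hx hd, e]
  congr 1
  ring

/-- The survival probability and `phi b r` sum up to at least `1`, up to an error of second
order per step. -/
lemma one_le_survival_add_phi (hρ : ρ = expMeasure a) (hσ : σ = expMeasure b) (ha : 0 < a)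
    (hb : 0 < b) (hα : 0 ≤ α) (hβ : 0 ≤ β) (hd : 0 ≤ d) {r : ℝ} (hr : 0 ≤ r) (hrb : r < b)
    (hroot : α * (a / (a + r)) + β * (b / (b - r)) ≤ α + β + r * d) (n : ℕ) (x : ℝ) :
    1 ≤ survival (stepLaw ρ σ α β) d n x + ENNReal.ofReal (phi b r x) +
      n * ENNReal.ofReal ((α + β) ^ 2) := by
  have := isProbabilityMeasure_stepLaw ρ σ hα hβ
  have hm := measurable_phi b r
  induction n generalizing x with
  | zero =>
    rcases lt_or_ge x 0 with hx | hx
    · simp [phi_of_neg hx]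
    · simp [survival, hx]
  | succ n ih =>
    rcases lt_or_ge x 0 with hx | hx
    · simp only [phi_of_neg hx, ENNReal.ofReal_one]
      exact le_add_right (le_add_left le_rfl)
    simp only [survival, if_pos hx]
    have h1 : 1 ≤ ∫⁻ y, (survival (stepLaw ρ σ α β) d n (x + d + y) +
        ENNReal.ofReal (phi b r (x + d + y)) + n * ENNReal.ofReal ((α + β) ^ 2))
          ∂stepLaw ρ σ α β := by
      calc (1 : ℝ≥0∞) = ∫⁻ _, 1 ∂stepLaw ρ σ α β := by simp
        _ ≤ _ := lintegral_mono fun y => ih _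
    -- Only the summand split off on the right has to be measurable, so `survival` may stay in the
    -- integral as it is.
    rw [lintegral_add_right _ measurable_const, lintegral_add_right _ (by fun_prop),
      lintegral_const, measure_univ, mul_one] at h1
    have h2 := lintegral_stepLaw_le ρ σ hα hβ
      (f := fun y => ENNReal.ofReal (phi b r (x + d + y))) (by fun_prop)
      (fun y => ENNReal.ofReal_le_one.2 (phi_le_one hb hr _))
    rw [singleJumpMean_phi hρ hσ ha hb hα hβ hd hr hrb hx] at h2
    have h3 : phi b r x * (Real.exp (-(α + β + r * d)) *
        (1 + (α * (a / (a + r)) + β * (b / (b - r))))) ≤ phi b r x := by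
      refine mul_le_of_le_one_right (phi_nonneg hb hrb x) ?_
      rw [Real.exp_neg]
      refine inv_mul_le_one_of_le₀ ?_ (Real.exp_nonneg _)
      linarith [Real.add_one_le_exp (α + β + r * d)]
    refine h1.trans ?_
    calc _ ≤ ∫⁻ y, survival (stepLaw ρ σ α β) d n (x + d + y) ∂stepLaw ρ σ α β +
          (ENNReal.ofReal (phi b r x) + ENNReal.ofReal ((α + β) ^ 2)) +
            n * ENNReal.ofReal ((α + β) ^ 2) := by
          gcongr
          exact h2.trans (by gcongr)
      _ = _ := by push_cast; ring

/-- The survival probability and `phi b r` sum up to at most `1`, up to an error of second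
order per step and a term that decays exponentially. -/
lemma survival_add_phi_le (hρ : ρ = expMeasure a) (hσ : σ = expMeasure b) (ha : 0 < a)
    (hb : 0 < b) (hα : 0 ≤ α) (hβ : 0 ≤ β) (hd : 0 ≤ d) {r s κ : ℝ} (hs : 0 ≤ s) (hsr : s ≤ r)
    (hrb : r < b) (hroot : α * (a / (a + r)) + β * (b / (b - r)) = α + β + r * d)
    (hκ : α * (a / (a + s)) + β * (b / (b - s)) ≤ α + β + s * d + κ) (hκ0 : κ ≤ 0)
    (n : ℕ) (x : ℝ) :
    survival (stepLaw ρ σ α β) d n x + ENNReal.ofReal (phi b r x) ≤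
      1 + n * ENNReal.ofReal ((α + β) ^ 2 + (α + β + r * d) ^ 2) +
        ENNReal.ofReal (Real.exp (n * κ)) * ENNReal.ofReal (phi b s x) := by
  have := isProbabilityMeasure_stepLaw ρ σ hα hβ
  have hr : 0 ≤ r := hs.trans hsr
  have hsb : s < b := hsr.trans_lt hrb
  have hm := measurable_phi b r
  have hm' := measurable_phi b s
  induction n generalizing x with
  | zero =>
    -- At the terminal time `phi b r` is dominated by `phi b s`. The last term of the bound starts
    -- from here.
    simp only [Nat.cast_zero, zero_mul, Real.exp_zero, ENNReal.ofReal_one, one_mul, add_zero]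
    gcongr
    · exact survival_le_one _ _ _ _
    · exact phi_le_of_le hb hsb hsr x
  | succ n ih =>
    rcases lt_or_ge x 0 with hx | hx
    · simp only [survival, if_neg hx.not_ge, phi_of_neg hx, ENNReal.ofReal_one, zero_add, add_assoc]
      exact le_self_add
    simp only [survival, if_pos hx]
    have h1 : ∫⁻ y, (survival (stepLaw ρ σ α β) d n (x + d + y) +
        ENNReal.ofReal (phi b r (x + d + y))) ∂stepLaw ρ σ α β ≤
        ∫⁻ y, (1 + n * ENNReal.ofReal ((α + β) ^ 2 + (α + β + r * d) ^ 2) +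
          ENNReal.ofReal (Real.exp (n * κ)) * ENNReal.ofReal (phi b s (x + d + y)))
          ∂stepLaw ρ σ α β := lintegral_mono fun y => ih _
    rw [lintegral_add_right _ (by fun_prop), lintegral_add_left measurable_const,
      lintegral_const_mul _ (by fun_prop), lintegral_const, measure_univ, mul_one] at h1
    have h2 := lintegral_stepLaw_le ρ σ hα hβ
      (f := fun y => ENNReal.ofReal (phi b s (x + d + y))) (by fun_prop)
      (fun y => ENNReal.ofReal_le_one.2 (phi_le_one hb hs _))
    rw [singleJumpMean_phi hρ hσ ha hb hα hβ hd hs hsb hx] at h2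
    have h3 := singleJumpMean_le ρ σ α β
      (f := fun y => ENNReal.ofReal (phi b r (x + d + y))) (by fun_prop)
    rw [singleJumpMean_phi hρ hσ ha hb hα hβ hd hr hrb hx, hroot] at h3
    -- The root makes `phi b r` almost invariant: one step loses at most `q ^ 2`, because `e^{-q} (1
    -- + q) ≥ 1 - q ^ 2` and `phi b r ≤ 1`.
    have h4 : ENNReal.ofReal (phi b r x) ≤
        ∫⁻ y, ENNReal.ofReal (phi b r (x + d + y)) ∂stepLaw ρ σ α β +
          ENNReal.ofReal ((α + β + r * d) ^ 2) := by
      refine le_trans ?_ (add_le_add_left h3 _)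
      have hp := phi_nonneg hb hrb x
      have hq : 0 ≤ α + β + r * d := by positivity
      rw [← ENNReal.ofReal_add (by positivity) (by positivity)]
      refine ENNReal.ofReal_le_ofReal ?_
      set q := α + β + r * d
      have he : 1 - q ^ 2 ≤ Real.exp (-q) * (1 + q) := by
        nlinarith [mul_le_mul_of_nonneg_right (Real.add_one_le_exp (-q)) (by positivity : 0 ≤ 1 + q)]
      nlinarith [mul_le_mul_of_nonneg_left he hp,
        mul_le_mul_of_nonneg_right (phi_le_one hb hr x) (sq_nonneg q)]
    -- One step multiplies `phi b s` by at most `e^κ`, up to the error from several jumps. Since `κ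
    -- ≤ 0`, the prefactor does not amplify this error, and errors only add up.
    have h5 : ENNReal.ofReal (Real.exp (n * κ)) *
        ∫⁻ y, ENNReal.ofReal (phi b s (x + d + y)) ∂stepLaw ρ σ α β ≤
        ENNReal.ofReal (Real.exp ((n + 1 : ℕ) * κ)) * ENNReal.ofReal (phi b s x) +
          ENNReal.ofReal ((α + β) ^ 2) := by
      have hp := phi_nonneg hb hsb x
      have he : Real.exp (-(α + β + s * d)) *
          (1 + (α * (a / (a + s)) + β * (b / (b - s)))) ≤ Real.exp κ := by
        calc _ ≤ Real.exp (-(α + β + s * d)) * Real.exp (α + β + s * d + κ) := by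
              gcongr
              linarith [Real.add_one_le_exp (α + β + s * d + κ)]
          _ = _ := by rw [← Real.exp_add]; ring_nf
      calc _ ≤ ENNReal.ofReal (Real.exp (n * κ)) *
            (ENNReal.ofReal (phi b s x * Real.exp κ) + ENNReal.ofReal ((α + β) ^ 2)) := by
            gcongr
            exact h2.trans (by gcongr)
        _ ≤ _ := by
            rw [mul_add]
            refine add_le_add (le_of_eq ?_) (mul_le_of_le_one_left zero_le ?_)
            · rw [← ENNReal.ofReal_mul (by positivity), ← ENNReal.ofReal_mul (by positivity)]
              congr 1
              push_cast
              rw [add_mul, Real.exp_add, one_mul]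
              ring
            · exact ENNReal.ofReal_le_one.2 (Real.exp_le_one_iff.2
                (mul_nonpos_of_nonneg_of_nonpos (Nat.cast_nonneg n) hκ0))
    calc _ ≤ ∫⁻ y, survival (stepLaw ρ σ α β) d n (x + d + y) ∂stepLaw ρ σ α β +
          (∫⁻ y, ENNReal.ofReal (phi b r (x + d + y)) ∂stepLaw ρ σ α β +
          ENNReal.ofReal ((α + β + r * d) ^ 2)) := by gcongr
      _ ≤ (1 + n * ENNReal.ofReal ((α + β) ^ 2 + (α + β + r * d) ^ 2) +
          (ENNReal.ofReal (Real.exp ((n + 1 : ℕ) * κ)) * ENNReal.ofReal (phi b s x) +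
          ENNReal.ofReal ((α + β) ^ 2))) + ENNReal.ofReal ((α + β + r * d) ^ 2) := by
          rw [← add_assoc]
          exact add_le_add_left (h1.trans (add_le_add_right h5 _)) _
      _ = _ := by
          rw [ENNReal.ofReal_add (by positivity) (by positivity)]
          push_cast
          ring

end Bounds

-- Renewal of the premium and claim sequences after a block.

/-- The two functions depend on coordinates in the disjoint index sets `Iio k` and `Ici k`. -/
lemma indepFun_sum_shift (ρ : Measure ℝ) [IsProbabilityMeasure ρ] (k : ℕ) :
    IndepFun (fun y : ℕ → ℝ => ∑ i ∈ Finset.range k, y i) (fun y i => y (i + k)) (seqLaw ρ) := by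
  have hind : iIndepFun (fun (i : ℕ) (y : ℕ → ℝ) => y i) (seqLaw ρ) :=
    iIndepFun_infinitePi (X := fun _ t => t) fun _ => measurable_id
  have h := indep_iSup_of_disjoint (fun i => (measurable_pi_apply i).comap_le) hind
    (S := Iio k) (T := Ici k) (Set.disjoint_left.2 fun i hi hi' =>
      absurd (mem_Ici.1 hi') (not_le.2 (mem_Iio.1 hi)))
  refine indep_of_indep_of_le_left (indep_of_indep_of_le_right h ?_) ?_
  · refine Measurable.comap_le ?_
    refine (@measurable_pi_iff _ _ _ (_) _ _).2 fun i => ?_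
    refine Measurable.of_comap_le ?_
    exact le_iSup₂_of_le (f := fun i (_ : i ∈ Ici k) =>
      MeasurableSpace.comap (fun y : ℕ → ℝ => y i) inferInstance) (i + k) (Nat.le_add_left k i)
      le_rfl
  · refine Measurable.comap_le ?_
    refine Finset.measurable_fun_sum _ fun i hi => ?_
    refine Measurable.of_comap_le ?_
    exact le_iSup₂_of_le (f := fun i (_ : i ∈ Iio k) =>
      MeasurableSpace.comap (fun y : ℕ → ℝ => y i) inferInstance) i (Finset.mem_range.1 hi)
      le_rfl

lemma map_seqLaw_sum_shift (ρ : Measure ℝ) [IsProbabilityMeasure ρ] (k : ℕ) :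
    (seqLaw ρ).map (fun y => (∑ i ∈ Finset.range k, y i, fun i => y (i + k))) =
      ((seqLaw ρ).map fun y => ∑ i ∈ Finset.range k, y i).prod (seqLaw ρ) := by
  rw [(indepFun_iff_map_prod_eq_prod_map_map (by fun_prop)
    (measurable_pi_lambda _ fun i => measurable_pi_apply (i + k)).aemeasurable).1
    (indepFun_sum_shift ρ k)]
  congr 1
  exact Measure.map_infinitePi_infinitePi_of_inj (P := fun _ : ℕ => ρ) (add_left_injective k)

/-- Used to regroup (block, remainder) pairs for premiums and for claims into a pair of blocks and a
pair of remainders. -/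
lemma map_prodProdProdComm {A B C D : Type*} [MeasurableSpace A] [MeasurableSpace B]
    [MeasurableSpace C] [MeasurableSpace D] (μA : Measure A) (μB : Measure B) (μC : Measure C)
    (μD : Measure D) [SFinite μA] [SFinite μB] [SFinite μC] [SFinite μD] :
    ((μA.prod μB).prod (μC.prod μD)).map (fun q => ((q.1.1, q.2.1), (q.1.2, q.2.2))) =
      (μA.prod μC).prod (μB.prod μD) := by
  refine Measure.ext_of_lintegral _ fun f hf => ?_
  rw [lintegral_map hf (by fun_prop), lintegral_prod _ (by fun_prop), lintegral_prod _ (by fun_prop),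
    lintegral_prod _ (by fun_prop), lintegral_prod _ (by fun_prop)]
  refine lintegral_congr fun x => ?_
  simp only
  have h1 : ∀ y, ∫⁻ z, f ((x, z.1), (y, z.2)) ∂μC.prod μD =
      ∫⁻ c, ∫⁻ z, f ((x, c), (y, z)) ∂μD ∂μC := fun y => lintegral_prod _ (by fun_prop)
  have h2 : ∀ c, ∫⁻ z, f ((x, c), z) ∂μB.prod μD =
      ∫⁻ y, ∫⁻ z, f ((x, c), (y, z)) ∂μD ∂μB := fun y => lintegral_prod _ (by fun_prop)
  simp_rw [h1, h2]
  refine lintegral_lintegral_swap ?_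
  exact (Measurable.lintegral_prod_right' (f := fun q : (B × C) × D => f ((x, q.1.2), (q.1.1, q.2)))
    (by fun_prop)).aemeasurable

/-- A block of premiums and claims is independent of the remaining ones, which have the original
law. -/
lemma map_blockSum_blockShift (ρ σ : Measure ℝ) [IsProbabilityMeasure ρ] [IsProbabilityMeasure σ]
    (p : ℕ × ℕ) :
    ((seqLaw ρ).prod (seqLaw σ)).map (fun q => (blockSum p q, blockShift p q)) =
      (blockLaw ρ σ p).prod ((seqLaw ρ).prod (seqLaw σ)) := by
  have h : ((seqLaw ρ).prod (seqLaw σ)).map (Prod.map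
      (fun y => (∑ i ∈ Finset.range p.1, y i, fun i => y (i + p.1)))
      (fun z => (∑ i ∈ Finset.range p.2, z i, fun i => z (i + p.2)))) =
      (((seqLaw ρ).map fun y => ∑ i ∈ Finset.range p.1, y i).prod (seqLaw ρ)).prod
        (((seqLaw σ).map fun y => ∑ i ∈ Finset.range p.2, y i).prod (seqLaw σ)) := by
    rw [← Measure.map_prod_map _ _ (by fun_prop) (by fun_prop), map_seqLaw_sum_shift,
      map_seqLaw_sum_shift]
  have := Measure.isProbabilityMeasure_map (μ := seqLaw ρ)
    (f := fun y => ∑ i ∈ Finset.range p.1, y i) (by fun_prop)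
  have := Measure.isProbabilityMeasure_map (μ := seqLaw σ)
    (f := fun y => ∑ i ∈ Finset.range p.2, y i) (by fun_prop)
  have h' := congrArg (Measure.map fun q => ((q.1.1, q.2.1), (q.1.2, q.2.2))) h
  rw [map_prodProdProdComm, Measure.map_map (by fun_prop) (by fun_prop),
    Measure.map_prod_map _ _ (by fun_prop) (by fun_prop)] at h'
  -- Subtracting the claim block from the premium block leaves the net change and the pair of
  -- remainders.
  have h'' := congrArg (Measure.map (Prod.map (fun t : ℝ × ℝ => t.1 - t.2) id)) h'
  rw [Measure.map_map (by fun_prop) (by fun_prop),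
    ← Measure.map_prod_map _ _ (by fun_prop) (by fun_prop), Measure.map_id,
    Measure.map_map (by fun_prop) (by fun_prop)] at h''
  exact h''

-- Survival along a grid with prescribed counts.

/-- The surplus started from `x` stays nonnegative along a grid, with drift `d` per step, if in
step `i` there are `(p i).1` premiums and `(p i).2` claims, taken from the sequences `q`. -/
def Survives (d : ℝ) : (n : ℕ) → (Fin n → ℕ × ℕ) → ℝ → (ℕ → ℝ) × (ℕ → ℝ) → Prop
  | 0, _, x, _ => 0 ≤ x
  | n + 1, p, x, q =>
    0 ≤ x ∧ Survives d n (Fin.tail p) (x + d + blockSum (p 0) q) (blockShift (p 0) q)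

lemma measurableSet_survives (d : ℝ) (n : ℕ) (p : Fin n → ℕ × ℕ) :
    MeasurableSet {v : ℝ × ((ℕ → ℝ) × (ℕ → ℝ)) | Survives d n p v.1 v.2} := by
  induction n with
  | zero =>
    simp only [Survives]
    exact measurableSet_le measurable_const measurable_fst
  | succ n ih =>
    have h1 := measurable_blockSum (p 0)
    have h2 := measurable_blockShift (p 0)
    simp only [Survives]
    refine (measurableSet_le measurable_const measurable_fst).inter ?_
    exact (ih (Fin.tail p)).preimage (f := fun v : ℝ × ((ℕ → ℝ) × (ℕ → ℝ)) =>
      (v.1 + d + blockSum (p 0) v.2, blockShift (p 0) v.2)) (by fun_prop)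

section Survives

variable (ρ σ : Measure ℝ) [IsProbabilityMeasure ρ] [IsProbabilityMeasure σ]

/-- Conditioning on the first block: the remaining sequences are independent of it and have the
original law. -/
lemma measure_survives_succ (d : ℝ) (n : ℕ) (p : Fin (n + 1) → ℕ × ℕ) (x : ℝ) :
    ((seqLaw ρ).prod (seqLaw σ)) {q | Survives d (n + 1) p x q} =
      if 0 ≤ x then ∫⁻ t, ((seqLaw ρ).prod (seqLaw σ)) {q | Survives d n (Fin.tail p) (x + d + t) q}
        ∂blockLaw ρ σ (p 0) else 0 := by
  split_ifs with hx
  · have hm : MeasurableSet {v : ℝ × ((ℕ → ℝ) × (ℕ → ℝ)) |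
        Survives d n (Fin.tail p) (x + d + v.1) v.2} :=
      (measurableSet_survives d n (Fin.tail p)).preimage
        (f := fun v : ℝ × ((ℕ → ℝ) × (ℕ → ℝ)) => (x + d + v.1, v.2)) (by fun_prop)
    have h := congrArg (fun μ : Measure (ℝ × ((ℕ → ℝ) × (ℕ → ℝ))) =>
      μ {v | Survives d n (Fin.tail p) (x + d + v.1) v.2}) (map_blockSum_blockShift ρ σ (p 0))
    rw [Measure.prod_apply hm, Measure.map_apply
      ((measurable_blockSum _).prodMk (measurable_blockShift _)) hm] at h
    simp only [Survives, hx, true_and]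
    exact h
  · simp [Survives, hx]

/-- Mixing over independent Poisson counts turns survival with prescribed counts into survival of
the walk. The first count is split off, and its sum is the integral against the step law. -/
lemma tsum_survives (α β d : ℝ) (n : ℕ) (x : ℝ) :
    ∑' p : Fin n → ℕ × ℕ, (∏ i, countWeight α β (p i)) *
      ((seqLaw ρ).prod (seqLaw σ)) {q | Survives d n p x q} =
    survival (stepLaw ρ σ α β) d n x := by
  induction n generalizing x with
  | zero =>
    rw [tsum_fintype]
    by_cases hx : 0 ≤ x <;> simp [Survives, survival, hx]
  | succ n ih =>
    rw [← (Fin.consEquiv fun _ => ℕ × ℕ).tsum_eq, ENNReal.tsum_prod']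
    simp only [Fin.consEquiv, Equiv.coe_fn_mk, Fin.prod_univ_succ, Fin.cons_zero, Fin.cons_succ,
      measure_survives_succ, Fin.tail_cons, survival]
    split_ifs with hx
    · rw [lintegral_stepLaw]
      refine tsum_congr fun p0 => ?_
      simp only [mul_assoc]
      rw [ENNReal.tsum_mul_left]
      congr 1
      simp_rw [← ih]
      have hm : ∀ p : Fin n → ℕ × ℕ, Measurable fun t =>
          ((seqLaw ρ).prod (seqLaw σ)) {q | Survives d n p (x + d + t) q} := fun p =>
        measurable_measure_prodMk_left ((measurableSet_survives d n p).preimage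
          (f := fun v : ℝ × ((ℕ → ℝ) × (ℕ → ℝ)) => (x + d + v.1, v.2)) (by fun_prop))
      rw [lintegral_tsum fun p => ((hm p).const_mul _).aemeasurable]
      exact tsum_congr fun p => (lintegral_const_mul _ (hm p)).symm
    · simp

/-- The survival event in terms of the partial sums along counting functions `m` and `l`. -/
lemma survives_iff (d : ℝ) (n : ℕ) (p : Fin n → ℕ × ℕ) (m l : ℕ → ℕ)
    (hm : ∀ i : Fin n, m (i + 1) = m i + (p i).1) (hl : ∀ i : Fin n, l (i + 1) = l i + (p i).2)
    (x : ℝ) (y z : ℕ → ℝ) :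
    Survives d n p x (fun i => y (i + m 0), fun i => z (i + l 0)) ↔
      ∀ j ≤ n, 0 ≤ x + d * j + (∑ i ∈ Finset.range (m j), y i - ∑ i ∈ Finset.range (m 0), y i) -
        (∑ i ∈ Finset.range (l j), z i - ∑ i ∈ Finset.range (l 0), z i) := by
  induction n generalizing x m l with
  | zero => simp [Survives]
  | succ n ih =>
    have hm0 : m 1 = m 0 + (p 0).1 := hm 0
    have hl0 : l 1 = l 0 + (p 0).2 := hl 0
    have hshift : blockShift (p 0) (fun i => y (i + m 0), fun i => z (i + l 0)) =
        (fun i => y (i + m 1), fun i => z (i + l 1)) := by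
      simp only [blockShift, hm0, hl0, add_comm, add_left_comm]
    have hsum : blockSum (p 0) (fun i => y (i + m 0), fun i => z (i + l 0)) =
        (∑ i ∈ Finset.range (m 1), y i - ∑ i ∈ Finset.range (m 0), y i) -
        (∑ i ∈ Finset.range (l 1), z i - ∑ i ∈ Finset.range (l 0), z i) := by
      rw [hm0, hl0, Finset.sum_range_add, Finset.sum_range_add]
      simp [blockSum, add_comm]
    -- The offsets `m 0` and `l 0` in the statement allow the induction to restart from the counts
    -- `m 1` and `l 1` after the first step.
    have := ih (Fin.tail p) (fun j => m (j + 1)) (fun j => l (j + 1))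
      (fun i => by simpa [Fin.tail] using hm i.succ) (fun i => by simpa [Fin.tail] using hl i.succ)
      (x + d + blockSum (p 0) (fun i => y (i + m 0), fun i => z (i + l 0)))
    simp only [zero_add] at this
    rw [Survives, hshift, this, hsum]
    constructor
    · rintro ⟨h0, h⟩ j hj
      rcases j with _ | j
      · simpa using h0
      · have := h j (by omega)
        push_cast
        linarith
    · refine fun h => ⟨by simpa using h 0 (by omega), fun j hj => ?_⟩
      have := h (j + 1) (by omega)
      push_cast at this
      linarith

end Survives

-- From the model to the random walk on a time grid.

section Grid

variable {Ω : Type*} [MeasurableSpace Ω]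

lemma measurable_countWeight (p : ℕ × ℕ) :
    Measurable fun v : ℝ × ℝ => countWeight v.1 v.2 p := by
  unfold countWeight poissonWeight
  fun_prop

/-- The countable series of `tsum_survives` has measurable weights in the intensities, multiplied by
constants. -/
lemma measurable_survival_stepLaw (ρ σ : Measure ℝ) [IsProbabilityMeasure ρ]
    [IsProbabilityMeasure σ] (d : ℝ) (n : ℕ) (x : ℝ) {A B : Ω → ℝ} (hA : Measurable A)
    (hB : Measurable B) :
    Measurable fun ω => survival (stepLaw ρ σ (A ω) (B ω)) d n x := by
  simp_rw [← tsum_survives]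
  refine Measurable.tsum fun p => Measurable.mul_const ?_ _
  exact Finset.measurable_fun_prod _ fun i _ => (measurable_countWeight (p i)).comp (hA.prodMk hB)

lemma measurable_surplus (u c : ℝ) {Z Y : ℕ → Ω → ℝ} {M L : ℝ≥0 → Ω → ℕ}
    (hZ : ∀ i, Measurable (Z i)) (hY : ∀ i, Measurable (Y i)) (hM : ∀ t, Measurable (M t))
    (hL : ∀ t, Measurable (L t)) (t : ℝ≥0) : Measurable (surplus u c Z Y M L t) := by
  have h : ∀ {X : ℕ → Ω → ℝ} {N : Ω → ℕ}, (∀ i, Measurable (X i)) → Measurable N →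
      Measurable fun ω => ∑ i ∈ Finset.range (N ω), X i ω := by
    intro X N hX hN
    have : Measurable fun v : ℕ × Ω => ∑ i ∈ Finset.range v.1, X i v.2 :=
      measurable_from_prod_countable_right fun n =>
        Finset.measurable_fun_sum (Finset.range n) fun i _ => hX i
    exact this.comp (hN.prodMk measurable_id)
  unfold surplus
  exact ((measurable_const.add (h hY (hM t))).sub (h hZ (hL t)))

/-- The event that the surplus is nonnegative at the times `0, h, …, n h`. -/
def gridSurvival (u c : ℝ) (Z Y : ℕ → Ω → ℝ) (M L : ℝ≥0 → Ω → ℕ) (h : ℝ≥0) (n : ℕ) : Set Ω :=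
  {ω | ∀ j ≤ n, 0 ≤ surplus u c Z Y M L (j * h) ω}

/-- The event that the premium and claim counts over the steps of a grid are given by `p`. -/
def gridCounts (M L : ℝ≥0 → Ω → ℕ) (h : ℝ≥0) {n : ℕ} (p : Fin n → ℕ × ℕ) : Set Ω :=
  {ω | ∀ i : Fin n, M ((i + 1 : ℕ) * h) ω = M (i * h) ω + (p i).1 ∧
    L ((i + 1 : ℕ) * h) ω = L (i * h) ω + (p i).2}

section Model

variable {P : Measure Ω} {Z Y : ℕ → Ω → ℝ} {M L : ℝ≥0 → Ω → ℕ}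
  {Δ Γ : Ω → ℝ}

lemma IsIIDPositive.map_eq_seqLaw {X : ℕ → Ω → ℝ} (hX : IsIIDPositive P X)
    [IsProbabilityMeasure (P.map (X 0))] :
    P.map (fun ω i => X i ω) = seqLaw (P.map (X 0)) := by
  rw [hX.indep.map_fun_eq_infinitePi_map hX.measurable]
  simp only [(hX.identDistrib _).map_eq]

lemma measurableSet_gridSurvival (hmodel : IsSurplusModel P Z Y M L Δ Γ) (u c : ℝ) (h : ℝ≥0)
    (n : ℕ) : MeasurableSet (gridSurvival u c Z Y M L h n) := by
  simp only [gridSurvival, ofPred_forall]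
  refine MeasurableSet.iInter fun j => MeasurableSet.iInter fun _ => ?_
  exact measurableSet_le measurable_const (measurable_surplus u c hmodel.claims.measurable
    hmodel.premiums.measurable hmodel.arrivals.measurable_M hmodel.arrivals.measurable_L _)

lemma IsCondPoissonPair.measure_gridCounts [IsProbabilityMeasure P] (hΔ : Measurable Δ)
    (hΓ : Measurable Γ)
    (hΔ0 : ∀ᵐ ω ∂P, 0 < Δ ω) (hΓ0 : ∀ᵐ ω ∂P, 0 < Γ ω) (harr : IsCondPoissonPair P M L Δ Γ)
    (h : ℝ≥0) {n : ℕ} (p : Fin n → ℕ × ℕ) :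
    P (gridCounts M L h p) = ∫⁻ ω, ∏ i, countWeight (Δ ω * h) (Γ ω * h) (p i) ∂P := by
  have hM := harr.measurable_M
  have hL := harr.measurable_L
  have hinc := harr.increments n (fun i => (i : ℕ) * h)
    (fun i j hij => mul_le_mul_left (Nat.cast_le.2 hij) _) (fun i => (p i).1) (fun i => (p i).2)
  have hset : {ω | ∀ i : Fin n, M (((i.succ : Fin (n + 1)) : ℕ) * h) ω =
        M (((i.castSucc : Fin (n + 1)) : ℕ) * h) ω + (p i).1 ∧
        L (((i.succ : Fin (n + 1)) : ℕ) * h) ω =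
        L (((i.castSucc : Fin (n + 1)) : ℕ) * h) ω + (p i).2} = gridCounts M L h p := by
    simp [gridCounts]
  rw [hset] at hinc
  have hmeas : MeasurableSet (gridCounts M L h p) := by
    simp only [gridCounts, ofPred_forall]
    refine MeasurableSet.iInter fun i => MeasurableSet.inter ?_ ?_
    · exact measurableSet_eq_fun (hM _) ((hM _).add measurable_const)
    · exact measurableSet_eq_fun (hL _) ((hL _).add measurable_const)
  have hle : MeasurableSpace.comap (fun ω => (Δ ω, Γ ω)) inferInstance ≤ ‹MeasurableSpace Ω› :=
    (hΔ.prodMk hΓ).comap_le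
  have hint := integral_condExp hle (μ := P) (f := (gridCounts M L h p).indicator fun _ => (1 : ℝ))
  rw [integral_indicator_const _ hmeas, smul_eq_mul, mul_one] at hint
  have hstep : ∀ i : Fin n, (((((i.succ : Fin (n + 1)) : ℕ) * h : ℝ≥0)) : ℝ) -
      ((((i.castSucc : Fin (n + 1)) : ℕ) * h : ℝ≥0) : ℝ) = h := by
    intro i
    simp only [Fin.val_succ, Fin.val_castSucc]
    push_cast
    ring
  simp only [hstep] at hinc
  have hprod : ∀ᵐ ω ∂P, ∏ i, countWeight (Δ ω * h) (Γ ω * h) (p i) = ENNReal.ofReal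
      (∏ i, (poissonWeight (Δ ω * h) (p i).1 * poissonWeight (Γ ω * h) (p i).2)) := by
    filter_upwards [hΔ0, hΓ0] with ω h1 h2
    rw [ENNReal.ofReal_prod_of_nonneg fun i _ => mul_nonneg
      (poissonWeight_nonneg (by positivity) _) (poissonWeight_nonneg (by positivity) _)]
    rfl
  -- The product is integrable because it agrees almost everywhere with a conditional expectation.
  rw [lintegral_congr_ae hprod, ← ofReal_integral_eq_lintegral_ofReal
    (integrable_condExp.congr hinc), ← integral_congr_ae hinc, hint, ofReal_measureReal]
  filter_upwards [hΔ0, hΓ0] with ω h1 h2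
  exact Finset.prod_nonneg fun i _ => mul_nonneg
    (poissonWeight_nonneg (by positivity) _) (poissonWeight_nonneg (by positivity) _)

/-- The event is partitioned by the counts in each step. On each piece it depends only on the sizes,
which are independent of the counts, and `tsum_survives` sums the pieces. -/
lemma measure_gridSurvival [IsProbabilityMeasure P] (hmodel : IsSurplusModel P Z Y M L Δ Γ)
    [IsProbabilityMeasure (P.map (Y 0))] [IsProbabilityMeasure (P.map (Z 0))]
    (u c : ℝ) (h : ℝ≥0) (n : ℕ) :
    P (gridSurvival u c Z Y M L h n) =
      ∫⁻ ω, survival (stepLaw (P.map (Y 0)) (P.map (Z 0)) (Δ ω * h) (Γ ω * h)) (c * h) n u ∂P := by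
  have hM := hmodel.arrivals.measurable_M
  have hL := hmodel.arrivals.measurable_L
  have hZ := hmodel.claims.measurable
  have hY := hmodel.premiums.measurable
  have hΔ := hmodel.measurable_Δ
  have hΓ := hmodel.measurable_Γ
  set F : (Fin n → ℕ × ℕ) → Set Ω := fun p =>
    {ω | Survives (c * h) n p u (fun i => Y i ω, fun i => Z i ω)} with hF
  have hEmeas : ∀ p : Fin n → ℕ × ℕ, MeasurableSet
      {v : (ℝ≥0 → ℕ) × (ℝ≥0 → ℕ) × ℝ × ℝ | ∀ i : Fin n,
        v.1 ((i + 1 : ℕ) * h) = v.1 (i * h) + (p i).1 ∧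
        v.2.1 ((i + 1 : ℕ) * h) = v.2.1 (i * h) + (p i).2} := by
    intro p
    have e1 : ∀ t : ℝ≥0, Measurable fun v : (ℝ≥0 → ℕ) × (ℝ≥0 → ℕ) × ℝ × ℝ => v.1 t :=
      fun t => (measurable_pi_apply t).comp measurable_fst
    have e2 : ∀ t : ℝ≥0, Measurable fun v : (ℝ≥0 → ℕ) × (ℝ≥0 → ℕ) × ℝ × ℝ => v.2.1 t :=
      fun t => (measurable_pi_apply t).comp (measurable_fst.comp measurable_snd)
    simp only [ofPred_forall]
    refine MeasurableSet.iInter fun i => MeasurableSet.inter ?_ ?_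
    · exact measurableSet_eq_fun (e1 _) ((e1 _).add measurable_const)
    · exact measurableSet_eq_fun (e2 _) ((e2 _).add measurable_const)
  have hSurv : ∀ p : Fin n → ℕ × ℕ,
      MeasurableSet {q : (ℕ → ℝ) × (ℕ → ℝ) | Survives (c * h) n p u q} := fun p =>
    (measurableSet_survives (c * h) n p).preimage
      (f := fun q : (ℕ → ℝ) × (ℕ → ℝ) => (u, q)) (by fun_prop)
  have hYm : Measurable fun ω i => Y i ω := measurable_pi_lambda _ hY
  have hZm : Measurable fun ω i => Z i ω := measurable_pi_lambda _ hZ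
  have hE : ∀ p, MeasurableSet (gridCounts M L h p : Set Ω) := fun p =>
    (hEmeas p).preimage (f := fun ω => ((fun t => M t ω : ℝ≥0 → ℕ), (fun t => L t ω : ℝ≥0 → ℕ),
      Δ ω, Γ ω)) ((measurable_pi_lambda _ hM).prodMk
        ((measurable_pi_lambda _ hL).prodMk (hΔ.prodMk hΓ)))
  have hFm : ∀ p, MeasurableSet (F p) := fun p => (hSurv p).preimage (hYm.prodMk hZm)
  have hPF : ∀ p, P (F p) = ((seqLaw (P.map (Y 0))).prod (seqLaw (P.map (Z 0))))
      {q | Survives (c * h) n p u q} := by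
    intro p
    rw [← hmodel.premiums.map_eq_seqLaw, ← hmodel.claims.map_eq_seqLaw,
      ← (indepFun_iff_map_prod_eq_prod_map_map hYm.aemeasurable hZm.aemeasurable).1
        hmodel.indep_claims_premiums.symm, Measure.map_apply (hYm.prodMk hZm) (hSurv p)]
    rfl
  have hinter : ∀ p, P (gridCounts M L h p ∩ F p) = P (gridCounts M L h p) * P (F p) := by
    intro p
    -- `Survives` takes premiums first and the model lists claims first, hence the swap.
    have := hmodel.indep_sizes_arrivals.symm.measure_inter_preimage_eq_mul _ _ (hEmeas p)
      ((hSurv p).preimage measurable_swap)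
    exact this
  have hunion : gridSurvival u c Z Y M L h n =ᵐ[P] ⋃ p, gridCounts M L h p ∩ F p := by
    have hiff : ∀ ω, M 0 ω = 0 → L 0 ω = 0 → ∀ p : Fin n → ℕ × ℕ, ω ∈ gridCounts M L h p →
        (ω ∈ gridSurvival u c Z Y M L h n ↔ ω ∈ F p) := by
      intro ω hM0 hL0 p hp
      have := survives_iff (c * h) n p (fun j => M (j * h) ω) (fun j => L (j * h) ω)
        (fun i => (hp i).1) (fun i => (hp i).2) u (fun i => Y i ω) (fun i => Z i ω)
      simp only [Nat.cast_zero, zero_mul, hM0, hL0, add_zero, Finset.range_zero,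
        Finset.sum_empty, sub_zero] at this
      rw [hF, mem_ofPred_eq, this, gridSurvival, mem_ofPred_eq]
      refine forall₂_congr fun j _ => ?_
      rw [surplus]
      push_cast
      rw [mul_right_comm, mul_assoc]
    rw [Filter.eventuallyEq_set]
    filter_upwards [hmodel.arrivals.paths_M, hmodel.arrivals.paths_L] with ω hMω hLω
    rw [mem_iUnion]
    constructor
    · intro hω
      -- Monotone paths make the truncated subtractions genuine increments. This holds almost
      -- surely, so the partition is only an almost sure one.
      have hp : ω ∈ gridCounts M L h fun i : Fin n =>
          (M ((i + 1 : ℕ) * h) ω - M (i * h) ω, L ((i + 1 : ℕ) * h) ω - L (i * h) ω) := by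
        intro i
        have hle : ((i : ℕ) : ℝ≥0) * h ≤ ((i + 1 : ℕ) : ℝ≥0) * h := by gcongr; omega
        have h1 : M (i * h) ω ≤ M ((i + 1 : ℕ) * h) ω := hMω.2.1 hle
        have h2 : L (i * h) ω ≤ L ((i + 1 : ℕ) * h) ω := hLω.2.1 hle
        exact ⟨(Nat.add_sub_of_le h1).symm, (Nat.add_sub_of_le h2).symm⟩
      exact ⟨_, hp, (hiff ω hMω.1 hLω.1 _ hp).1 hω⟩
    · rintro ⟨p, hp, hω⟩
      exact (hiff ω hMω.1 hLω.1 p hp).2 hω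
  have hdisj : Pairwise (Function.onFun Disjoint fun p => gridCounts M L h p ∩ F p) := by
    intro p p' hpp
    refine Set.disjoint_left.2 fun ω hω hω' => hpp ?_
    funext i
    have h1 := hω.1 i
    have h2 := hω'.1 i
    exact Prod.ext (by omega) (by omega)
  rw [measure_congr hunion, measure_iUnion hdisj fun p => (hE p).inter (hFm p)]
  simp_rw [hinter, hPF, hmodel.arrivals.measure_gridCounts hΔ hΓ hmodel.pos_Δ hmodel.pos_Γ,
    ← tsum_survives]
  have hw : ∀ p : Fin n → ℕ × ℕ,
      Measurable fun ω => ∏ i, countWeight (Δ ω * h) (Γ ω * h) (p i) := fun p =>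
    Finset.measurable_fun_prod _ fun i _ => (measurable_countWeight (p i)).comp
      ((hΔ.mul_const _).prodMk (hΓ.mul_const _))
  rw [lintegral_tsum fun p => ((hw p).mul_const _).aemeasurable]
  exact tsum_congr fun p => (lintegral_mul_const _ (hw p)).symm

end Model

-- Limits of the survival probabilities for fixed intensities.

section Limit

variable {ρ σ : Measure ℝ} [IsProbabilityMeasure ρ] [IsProbabilityMeasure σ] {a b c γ δ : ℝ}

/-- Converts the adjustment equation into the eigenvalue condition: the last bracket equals `c` when
`s` is a root. -/
lemma compound_mean_eq {s : ℝ} (has : a + s ≠ 0) (hbs : b - s ≠ 0) :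
    δ * (a / (a + s)) + γ * (b / (b - s)) = δ + γ + s * (γ / (b - s) - δ / (a + s)) := by
  field_simp
  ring

lemma sub_phi_sub_le_survival (hρ : ρ = expMeasure a) (hσ : σ = expMeasure b) (ha : 0 < a)
    (hb : 0 < b) (hδ : 0 ≤ δ) (hγ : 0 ≤ γ) (hc : 0 ≤ c) {r : ℝ}
    (hr : IsAdjustmentRoot a b c γ δ r) {h : ℝ} (hh : 0 ≤ h) (n : ℕ) (x : ℝ) :
    1 - phi b r x - n * ((δ + γ) * h) ^ 2 ≤
      (survival (stepLaw ρ σ (δ * h) (γ * h)) (c * h) n x).toReal := by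
  obtain ⟨⟨hr0, hrb⟩, hr⟩ := hr
  have := isProbabilityMeasure_stepLaw ρ σ (mul_nonneg hδ hh) (mul_nonneg hγ hh)
  have hq := compound_mean_eq (δ := δ) (γ := γ) (add_pos ha hr0).ne' (sub_pos.2 hrb).ne'
  rw [← hr, add_sub_cancel_right] at hq
  have hS := ne_top_of_le_ne_top ENNReal.one_ne_top
    (survival_le_one (stepLaw ρ σ (δ * h) (γ * h)) (c * h) n x)
  have key := one_le_survival_add_phi hρ hσ ha hb (mul_nonneg hδ hh) (mul_nonneg hγ hh)
    (mul_nonneg hc hh) hr0.le hrb (le_of_eq (by linear_combination h * hq)) n x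
  have key' := ENNReal.toReal_mono (by finiteness) key
  rw [ENNReal.toReal_add (by finiteness) (by finiteness),
    ENNReal.toReal_add hS (by finiteness), ENNReal.toReal_ofReal (phi_nonneg hb hrb x),
    ENNReal.toReal_mul, ENNReal.toReal_ofReal (by positivity), ENNReal.toReal_natCast,
    ENNReal.toReal_one] at key'
  rw [add_mul]
  linarith

lemma survival_le_sub_phi_add (hρ : ρ = expMeasure a) (hσ : σ = expMeasure b) (ha : 0 < a)
    (hb : 0 < b) (hδ : 0 ≤ δ) (hγ : 0 < γ) (hc : 0 ≤ c) {r : ℝ}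
    (hr : IsAdjustmentRoot a b c γ δ r) :
    ∃ κ < 0, ∀ (h : ℝ) (_ : 0 ≤ h) (n : ℕ) (x : ℝ),
      (survival (stepLaw ρ σ (δ * h) (γ * h)) (c * h) n x).toReal ≤ 1 - phi b r x +
        n * (((δ + γ) * h) ^ 2 + ((δ + γ + r * c) * h) ^ 2) + Real.exp (n * (κ * h)) := by
  obtain ⟨⟨hr0, hrb⟩, hr⟩ := hr
  have hq := compound_mean_eq (δ := δ) (γ := γ) (add_pos ha hr0).ne' (sub_pos.2 hrb).ne'
  rw [← hr, add_sub_cancel_right] at hq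
  have hbr : 0 < b - r := sub_pos.2 hrb
  have hbs : 0 < b - r / 2 := by linarith
  have has : 0 < a + r / 2 := by positivity
  have hq' := compound_mean_eq (δ := δ) (γ := γ) has.ne' hbs.ne'
  -- The bracket is strictly increasing in `s`, so at `s = r / 2` it falls below its value `c` at
  -- the root. This makes the decay rate `κ` negative.
  have hlt : γ / (b - r / 2) - δ / (a + r / 2) < c := by
    have h1 : γ / (b - r / 2) < γ / (b - r) := by gcongr; linarith
    have h2 : δ / (a + r) ≤ δ / (a + r / 2) := by gcongr; linarith
    linarith
  refine ⟨r / 2 * (γ / (b - r / 2) - δ / (a + r / 2) - c),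
    mul_neg_of_pos_of_neg (by positivity) (sub_neg.2 hlt), fun h hh n x => ?_⟩
  set κ := r / 2 * (γ / (b - r / 2) - δ / (a + r / 2) - c) with hκ
  have hκ0 : κ ≤ 0 := mul_nonpos_of_nonneg_of_nonpos (by positivity) (sub_neg.2 hlt).le
  have := isProbabilityMeasure_stepLaw ρ σ (mul_nonneg hδ hh) (mul_nonneg hγ.le hh)
  have hS := ne_top_of_le_ne_top ENNReal.one_ne_top
    (survival_le_one (stepLaw ρ σ (δ * h) (γ * h)) (c * h) n x)
  have key := survival_add_phi_le hρ hσ ha hb (mul_nonneg hδ hh) (mul_nonneg hγ.le hh)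
    (mul_nonneg hc hh) (s := r / 2) (κ := κ * h) (by positivity) (by linarith) hrb
    (by linear_combination h * hq) (le_of_eq (by rw [hκ]; linear_combination h * hq'))
    (mul_nonpos_of_nonpos_of_nonneg hκ0 hh) n x
  have key' := ENNReal.toReal_mono (by finiteness) key
  rw [ENNReal.toReal_add hS (by finiteness), ENNReal.toReal_add (by finiteness) (by finiteness),
    ENNReal.toReal_add (by finiteness) (by finiteness), ENNReal.toReal_ofReal (phi_nonneg hb hrb x),
    ENNReal.toReal_mul, ENNReal.toReal_mul, ENNReal.toReal_ofReal (by positivity),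
    ENNReal.toReal_ofReal (by positivity),
    ENNReal.toReal_ofReal (phi_nonneg hb (by linarith) x), ENNReal.toReal_natCast,
    ENNReal.toReal_one] at key'
  have hle := mul_le_of_le_one_right (Real.exp_nonneg (n * (κ * h)))
    (phi_le_one hb (by positivity : 0 ≤ r / 2) x)
  have e : n * ((δ * h + γ * h) ^ 2 + (δ * h + γ * h + r * (c * h)) ^ 2) =
    n * (((δ + γ) * h) ^ 2 + ((δ + γ + r * c) * h) ^ 2) := by ring
  linarith

/-- Along the dyadic grids of mesh `2 ^ (-m)` and length `m`, the survival probabilities converge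
to `1 - phi b r` if `r` is the adjustment coefficient. -/
lemma tendsto_survival_of_isAdjustmentRoot (hρ : ρ = expMeasure a) (hσ : σ = expMeasure b)
    (ha : 0 < a) (hb : 0 < b) (hδ : 0 ≤ δ) (hγ : 0 < γ) (hc : 0 ≤ c) {r : ℝ}
    (hr : IsAdjustmentRoot a b c γ δ r) (x : ℝ) :
    Tendsto (fun m : ℕ => (survival (stepLaw ρ σ (δ * (2 ^ m)⁻¹) (γ * (2 ^ m)⁻¹))
      (c * (2 ^ m)⁻¹) (m * 2 ^ m) x).toReal) atTop (𝓝 (1 - phi b r x)) := by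
  obtain ⟨κ, hκ, hle⟩ := survival_le_sub_phi_add hρ hσ ha hb hδ hγ hc hr
  -- With `m * 2 ^ m` steps of length `2 ^ (-m)`, the accumulated second-order error is a multiple
  -- of `m * 2 ^ (-m)`.
  have h0 : ∀ C : ℝ, Tendsto (fun m : ℕ => ((m * 2 ^ m : ℕ) : ℝ) * (C * ((2 : ℝ) ^ m)⁻¹) ^ 2)
      atTop (𝓝 0) := by
    intro C
    have := (tendsto_self_mul_const_pow_of_lt_one (r := (1 / 2 : ℝ)) (by norm_num)
      (by norm_num)).const_mul (C ^ 2)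
    rw [mul_zero] at this
    refine this.congr fun m => ?_
    push_cast
    rw [one_div, inv_pow]
    field_simp
  -- Number of steps times mesh is `m`, so the exponential equals `e^{mκ}`.
  have h1 : Tendsto (fun m : ℕ => Real.exp (((m * 2 ^ m : ℕ) : ℝ) * (κ * ((2 : ℝ) ^ m)⁻¹)))
      atTop (𝓝 0) := by
    have : Tendsto (fun m : ℕ => (m : ℝ) * κ) atTop atBot :=
      tendsto_natCast_atTop_atTop.atTop_mul_const_of_neg hκ
    refine (Real.tendsto_exp_atBot.comp this).congr fun m => ?_
    simp only [Function.comp_apply]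
    push_cast
    congr 1
    field_simp
  refine tendsto_of_tendsto_of_tendsto_of_le_of_le
    (g := fun m : ℕ => 1 - phi b r x - ((m * 2 ^ m : ℕ) : ℝ) * ((δ + γ) * ((2 : ℝ) ^ m)⁻¹) ^ 2)
    (h := fun m : ℕ => 1 - phi b r x + ((m * 2 ^ m : ℕ) : ℝ) * (((δ + γ) * ((2 : ℝ) ^ m)⁻¹) ^ 2 +
      ((δ + γ + r * c) * ((2 : ℝ) ^ m)⁻¹) ^ 2) +
      Real.exp (((m * 2 ^ m : ℕ) : ℝ) * (κ * ((2 : ℝ) ^ m)⁻¹))) ?_ ?_ ?_ ?_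
  · simpa using (tendsto_const_nhds (x := 1 - phi b r x)).sub (h0 (δ + γ))
  · have := ((tendsto_const_nhds (x := 1 - phi b r x)).add
      ((h0 (δ + γ)).add (h0 (δ + γ + r * c)))).add h1
    simpa only [mul_add, add_zero] using this
  · exact fun m => sub_phi_sub_le_survival hρ hσ ha hb hδ hγ.le hc hr (by positivity) _ _
  · exact fun m => hle _ (by positivity) _ _

/-- Without positive drift, the survival probabilities converge to `0`. -/
lemma tendsto_survival_of_le (hρ : ρ = expMeasure a) (hσ : σ = expMeasure b) (ha : 0 < a)
    (hb : 0 < b) (hδ : 0 ≤ δ) (hγ : 0 < γ) (hc : 0 ≤ c) (hdrift : c ≤ γ / b - δ / a) {x : ℝ}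
    (hx : 0 ≤ x) :
    Tendsto (fun m : ℕ => (survival (stepLaw ρ σ (δ * (2 ^ m)⁻¹) (γ * (2 ^ m)⁻¹))
      (c * (2 ^ m)⁻¹) (m * 2 ^ m) x).toReal) atTop (𝓝 0) := by
  refine tendsto_order.2 ⟨fun ε hε => .of_forall fun m => hε.trans_le ENNReal.toReal_nonneg,
    fun ε hε => ?_⟩
  have hlim : Tendsto (fun r => 1 - (1 - r / b) * Real.exp (-r * x)) (𝓝[>] 0) (𝓝 0) := by
    have : Continuous fun r => 1 - (1 - r / b) * Real.exp (-r * x) := by fun_prop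
    simpa using (this.tendsto 0).mono_left nhdsWithin_le_nhds
  obtain ⟨r, hrε, hr0, hrb⟩ :=
    ((hlim.eventually (gt_mem_nhds hε)).and (Ioo_mem_nhdsGT hb)).exists
  rw [← phi_of_nonneg hx] at hrε
  have hbr : 0 < b - r := sub_pos.2 hrb
  -- The right-hand side is the premium rate for which `r` is a root. Raising `c` to it can only
  -- increase survival, and `r` was chosen with `1 - phi b r x < ε`.
  have hcr : c ≤ γ / (b - r) - δ / (a + r) := by
    have h1 : γ / b ≤ γ / (b - r) := by gcongr; linarith
    have h2 : δ / (a + r) ≤ δ / a := by gcongr; linarith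
    linarith
  have ht := tendsto_survival_of_isAdjustmentRoot hρ hσ ha hb hδ hγ (hc.trans hcr)
    (r := r) ⟨⟨hr0, hrb⟩, by ring⟩ x
  filter_upwards [ht.eventually (gt_mem_nhds hrε)] with m hm
  refine lt_of_le_of_lt ?_ hm
  have := isProbabilityMeasure_stepLaw ρ σ (α := δ * (2 ^ m)⁻¹) (β := γ * (2 ^ m)⁻¹)
    (by positivity) (by positivity)
  refine ENNReal.toReal_mono (ne_top_of_le_ne_top ENNReal.one_ne_top (survival_le_one _ _ _ _))
    (survival_mono _ ?_ _ le_rfl)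
  gcongr

end Limit

end Grid

-- From dyadic grids to continuous time.

section Ruin

variable {Ω : Type*}

lemma mem_ruin_iff {u c : ℝ} {Z Y : ℕ → Ω → ℝ} {M L : ℝ≥0 → Ω → ℕ} {ω : Ω} :
    ω ∈ ruin u c Z Y M L ↔ ∃ t, surplus u c Z Y M L t ω < 0 := by
  simp only [ruin, mem_ofPred_eq, iInf_lt_iff]
  exact exists_congr fun t => by exact_mod_cast Iff.rfl

/-- Survival up to time `m` along the dyadic grid of mesh `2 ^ (-m)`. -/
def dyadicSurvival (u c : ℝ) (Z Y : ℕ → Ω → ℝ) (M L : ℝ≥0 → Ω → ℕ) (m : ℕ) : Set Ω :=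
  gridSurvival u c Z Y M L (2 ^ m)⁻¹ (m * 2 ^ m)

lemma antitone_dyadicSurvival (u c : ℝ) (Z Y : ℕ → Ω → ℝ) (M L : ℝ≥0 → Ω → ℕ) :
    Antitone (dyadicSurvival u c Z Y M L) := by
  refine antitone_nat_of_succ_le fun m ω hω j hj => ?_
  -- The point `j` of the grid of level `m` is the point `2 * j` of the next one.
  have := hω (2 * j) (by
    have := Nat.zero_le (2 ^ m)
    rw [pow_succ]
    linarith [add_mul m 1 (2 ^ m * 2)])
  have e : ((2 * j : ℕ) : ℝ≥0) * (2 ^ (m + 1))⁻¹ = j * (2 ^ m)⁻¹ := by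
    push_cast
    field_simp
    ring
  rwa [e] at this

/-- Dyadic approximation from the right, the side on which the paths are continuous. -/
lemma tendsto_ceil_mul_two_pow (t : ℝ≥0) :
    Tendsto (fun m : ℕ => (⌈t * 2 ^ m⌉₊ : ℝ≥0) * (2 ^ m)⁻¹) atTop (𝓝[≥] t) := by
  have hle : ∀ m : ℕ, t ≤ (⌈t * 2 ^ m⌉₊ : ℝ≥0) * (2 ^ m)⁻¹ := fun m => by
    rw [← div_eq_mul_inv, le_div_iff₀ (by positivity)]
    exact Nat.le_ceil _
  refine tendsto_nhdsWithin_iff.2 ⟨?_, .of_forall hle⟩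
  refine tendsto_of_tendsto_of_tendsto_of_le_of_le (h := fun m : ℕ => t + (2⁻¹) ^ m)
    tendsto_const_nhds ?_ hle fun m => ?_
  · have : Tendsto (fun m : ℕ => (2⁻¹ : ℝ≥0) ^ m) atTop (𝓝 0) :=
      NNReal.tendsto_pow_atTop_nhds_zero_of_lt_one (inv_lt_one_of_one_lt₀ one_lt_two)
    simpa using this.const_add t
  · beta_reduce
    rw [inv_pow, ← div_eq_mul_inv, div_le_iff₀ (by positivity), add_mul,
      inv_mul_cancel₀ (by positivity)]
    exact (Nat.ceil_lt_add_one (by positivity)).le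

lemma exists_notMem_dyadicSurvival {u c : ℝ} {Z Y : ℕ → Ω → ℝ} {M L : ℝ≥0 → Ω → ℕ} {ω : Ω}
    (hM : ∀ t, ContinuousWithinAt (fun s => M s ω) (Ici t) t)
    (hL : ∀ t, ContinuousWithinAt (fun s => L s ω) (Ici t) t)
    (hω : ω ∈ ruin u c Z Y M L) : ∃ m, ω ∉ dyadicSurvival u c Z Y M L m := by
  obtain ⟨t, ht⟩ := mem_ruin_iff.1 hω
  have hcont : Tendsto (fun s => surplus u c Z Y M L s ω) (𝓝[≥] t)
      (𝓝 (surplus u c Z Y M L t ω)) := by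
    have hlin : Tendsto (fun s : ℝ≥0 => u + c * (s : ℝ)) (𝓝[≥] t) (𝓝 (u + c * t)) :=
      ((by fun_prop : Continuous fun s : ℝ≥0 => u + c * (s : ℝ)).tendsto t).mono_left
        nhdsWithin_le_nhds
    have hY : Tendsto (fun s => ∑ i ∈ Finset.range (M s ω), Y i ω) (𝓝[≥] t)
        (𝓝 (∑ i ∈ Finset.range (M t ω), Y i ω)) :=
      (continuous_of_discreteTopology
        (f := fun k : ℕ => ∑ i ∈ Finset.range k, Y i ω)).continuousAt.tendsto.comp (hM t)
    have hZ : Tendsto (fun s => ∑ i ∈ Finset.range (L s ω), Z i ω) (𝓝[≥] t)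
        (𝓝 (∑ i ∈ Finset.range (L t ω), Z i ω)) :=
      (continuous_of_discreteTopology
        (f := fun k : ℕ => ∑ i ∈ Finset.range k, Z i ω)).continuousAt.tendsto.comp (hL t)
    exact (hlin.add hY).sub hZ
  -- The level must be fine enough for the surplus to be still negative at the rounded time, and at
  -- least `t` for that time to lie within the horizon `m`.
  obtain ⟨m, hm, hmt⟩ := (((hcont.comp (tendsto_ceil_mul_two_pow t)).eventually
    (gt_mem_nhds ht)).and (tendsto_natCast_atTop_atTop.eventually_ge_atTop t)).exists
  refine ⟨m, fun h => not_le_of_gt hm (h _ (Nat.ceil_le.2 ?_))⟩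
  push_cast
  gcongr

section Model

variable [MeasurableSpace Ω] {P : Measure Ω} {Z Y : ℕ → Ω → ℝ} {M L : ℝ≥0 → Ω → ℕ} {Δ Γ : Ω → ℝ}

lemma IsSurplusModel.compl_ruin_ae_eq (hmodel : IsSurplusModel P Z Y M L Δ Γ) (u c : ℝ) :
    (ruin u c Z Y M L)ᶜ =ᵐ[P] ⋂ m, dyadicSurvival u c Z Y M L m := by
  refine Filter.eventuallyEq_set.2 ?_
  filter_upwards [hmodel.arrivals.paths_M, hmodel.arrivals.paths_L] with ω hM hL
  rw [mem_iInter]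
  constructor
  · intro hω m j _
    by_contra hlt
    exact hω (mem_ruin_iff.2 ⟨_, not_le.1 hlt⟩)
  · intro h hω
    obtain ⟨m, hm⟩ := exists_notMem_dyadicSurvival hM.2.2 hL.2.2 hω
    exact hm (h m)

/-- Ruin involves uncountably many times; off a null set it is the complement of a countable
intersection of grid events. -/
lemma IsSurplusModel.nullMeasurableSet_ruin (hmodel : IsSurplusModel P Z Y M L Δ Γ) (u c : ℝ) :
    NullMeasurableSet (ruin u c Z Y M L) P := by
  refine NullMeasurableSet.compl_iff.1 ?_
  exact (MeasurableSet.iInter fun m =>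
    measurableSet_gridSurvival hmodel u c _ _).nullMeasurableSet.congr (hmodel.compl_ruin_ae_eq u c).symm

lemma IsSurplusModel.tendsto_dyadicSurvival [IsProbabilityMeasure P]
    (hmodel : IsSurplusModel P Z Y M L Δ Γ) (u c : ℝ) :
    Tendsto (fun m => P.real (dyadicSurvival u c Z Y M L m)) atTop
      (𝓝 (1 - ruinProb P c Z Y M L u)) := by
  have h := tendsto_measure_iInter_atTop (μ := P) (s := dyadicSurvival u c Z Y M L)
    (fun m => (measurableSet_gridSurvival hmodel u c _ _).nullMeasurableSet)
    (antitone_dyadicSurvival u c Z Y M L) ⟨0, measure_ne_top _ _⟩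
  rw [← measure_congr (hmodel.compl_ruin_ae_eq u c)] at h
  rw [ruinProb, ← probReal_compl_eq_one_sub₀ (hmodel.nullMeasurableSet_ruin u c)]
  exact (ENNReal.tendsto_toReal (measure_ne_top P _)).comp h

-- Integration over the random intensities.

variable {a b c : ℝ} {R : ℝ × ℝ → ℝ}

/-- The ruin probability given the intensities, in terms of the adjustment coefficient `R`. -/
def condRuinProb (a b c u : ℝ) (R : ℝ × ℝ → ℝ) (p : ℝ × ℝ) : ℝ :=
  (1 - R p / b) * Real.exp (-(R p) * u) * (Iio c).indicator 1 (p.1 / b - p.2 / a)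

lemma condRuinProb_eq_phi {u : ℝ} (hu : 0 ≤ u) {p : ℝ × ℝ} (hp : p.1 / b - p.2 / a < c) :
    condRuinProb a b c u R p = phi b (R p) u := by
  simp [condRuinProb, phi_of_nonneg hu, hp]

lemma condRuinProb_eq_zero {u : ℝ} {p : ℝ × ℝ} (hp : c ≤ p.1 / b - p.2 / a) :
    condRuinProb a b c u R p = 0 := by
  simp [condRuinProb, hp]

lemma measurable_condRuinProb (a b c u : ℝ) (hR : Measurable R) :
    Measurable (condRuinProb a b c u R) := by
  unfold condRuinProb
  have : Measurable ((Iio c).indicator (1 : ℝ → ℝ)) := measurable_one.indicator measurableSet_Iio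
  fun_prop

lemma abs_condRuinProb_le_one (hb : 0 < b)
    (hroot : ∀ γ δ, 0 < γ → 0 < δ → γ / b - δ / a < c → IsAdjustmentRoot a b c γ δ (R (γ, δ)))
    {u : ℝ} (hu : 0 ≤ u) {p : ℝ × ℝ} (h1 : 0 < p.1) (h2 : 0 < p.2) :
    |condRuinProb a b c u R p| ≤ 1 := by
  rcases lt_or_ge (p.1 / b - p.2 / a) c with hp | hp
  · obtain ⟨⟨hr0, hrb⟩, -⟩ := hroot p.1 p.2 h1 h2 hp
    rw [condRuinProb_eq_phi hu hp, abs_of_nonneg (phi_nonneg hb hrb u)]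
    exact phi_le_one hb hr0.le u
  · simp [condRuinProb_eq_zero hp]

lemma IsSurplusModel.integrableOn_condRuinProb [IsProbabilityMeasure P]
    (hmodel : IsSurplusModel P Z Y M L Δ Γ) (hb : 0 < b) (hR : Measurable R)
    (hroot : ∀ γ δ, 0 < γ → 0 < δ → γ / b - δ / a < c → IsAdjustmentRoot a b c γ δ (R (γ, δ)))
    {u : ℝ} (hu : 0 ≤ u) :
    IntegrableOn (condRuinProb a b c u R) (Ioi 0 ×ˢ Ioi 0) (P.map fun ω => (Γ ω, Δ ω)) := by
  have := Measure.isProbabilityMeasure_map (μ := P) (f := fun ω => (Γ ω, Δ ω))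
    (hmodel.measurable_Γ.prodMk hmodel.measurable_Δ).aemeasurable
  refine Measure.integrableOn_of_bounded (M := 1) (measure_ne_top _ _)
    (measurable_condRuinProb a b c u hR).aestronglyMeasurable ?_
  filter_upwards [ae_restrict_mem (measurableSet_Ioi.prod measurableSet_Ioi)] with p hp
  exact abs_condRuinProb_le_one hb hroot hu hp.1 hp.2

/-- The root enters only through a measurable selection `R`, so that `c > 0` and `c = 0` share one
argument. -/
theorem IsSurplusModel.ruinProb_eq [IsProbabilityMeasure P]
    (hmodel : IsSurplusModel P Z Y M L Δ Γ) (ha : 0 < a) (hb : 0 < b)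
    (hY : P.map (Y 0) = expMeasure a) (hZ : P.map (Z 0) = expMeasure b) (hc : 0 ≤ c)
    (hR : Measurable R)
    (hroot : ∀ γ δ, 0 < γ → 0 < δ → γ / b - δ / a < c → IsAdjustmentRoot a b c γ δ (R (γ, δ)))
    {u : ℝ} (hu : 0 ≤ u) :
    ruinProb P c Z Y M L u =
      (∫ p in Ioi 0 ×ˢ Ioi 0, condRuinProb a b c u R p ∂(P.map fun ω => (Γ ω, Δ ω))) +
        P.real {ω | Γ ω / b - Δ ω / a ≥ c} := by
  have hΔ := hmodel.measurable_Δ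
  have hΓ := hmodel.measurable_Γ
  have hΓΔ : Measurable fun ω => (Γ ω, Δ ω) := hΓ.prodMk hΔ
  have := Measure.isProbabilityMeasure_map (μ := P) (f := Y 0)
    (hmodel.premiums.measurable 0).aemeasurable
  have := Measure.isProbabilityMeasure_map (μ := P) (f := Z 0)
    (hmodel.claims.measurable 0).aemeasurable
  have hA : MeasurableSet {ω | Γ ω / b - Δ ω / a ≥ c} :=
    measurableSet_le measurable_const (by fun_prop)
  have hmem : ∀ᵐ p ∂(P.map fun ω => (Γ ω, Δ ω)), p ∈ Ioi (0 : ℝ) ×ˢ Ioi (0 : ℝ) := by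
    refine (ae_map_iff hΓΔ.aemeasurable (measurableSet_Ioi.prod measurableSet_Ioi)).2 ?_
    filter_upwards [hmodel.pos_Δ, hmodel.pos_Γ] with ω h1 h2 using ⟨h2, h1⟩
  have hint := hmodel.integrableOn_condRuinProb hb hR hroot hu
  have hmeas := measurable_condRuinProb a b c u hR
  rw [IntegrableOn, Measure.restrict_eq_self_of_ae_mem hmem,
    integrable_map_measure hmeas.aestronglyMeasurable hΓΔ.aemeasurable] at hint
  rw [Measure.restrict_eq_self_of_ae_mem hmem, integral_map hΓΔ.aemeasurable
    hmeas.aestronglyMeasurable, ← integral_indicator_one hA]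
  refine Eq.trans ?_ (integral_add hint ((integrable_const (1 : ℝ)).indicator hA))
  -- `G` is the conditional ruin probability given the intensities: `phi` under positive drift and 1
  -- otherwise.
  set G : Ω → ℝ := fun ω => condRuinProb a b c u R (Γ ω, Δ ω) +
    {ω | Γ ω / b - Δ ω / a ≥ c}.indicator 1 ω with hG
  have hGint : Integrable G P := hint.add ((integrable_const (1 : ℝ)).indicator hA)
  have hlim : Tendsto (fun m => P.real (dyadicSurvival u c Z Y M L m)) atTop
      (𝓝 (∫ ω, (1 - G ω) ∂P)) := by
    have hS1 : ∀ m : ℕ, ∀ᵐ ω ∂P, survival (stepLaw (P.map (Y 0)) (P.map (Z 0))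
        (Δ ω * (2 ^ m)⁻¹) (Γ ω * (2 ^ m)⁻¹)) (c * (2 ^ m)⁻¹) (m * 2 ^ m) u ≤ 1 := by
      intro m
      filter_upwards [hmodel.pos_Δ, hmodel.pos_Γ] with ω h1 h2
      have := isProbabilityMeasure_stepLaw (P.map (Y 0)) (P.map (Z 0))
        (α := Δ ω * (2 ^ m)⁻¹) (β := Γ ω * (2 ^ m)⁻¹) (by positivity) (by positivity)
      exact survival_le_one _ _ _ _
    have hSm : ∀ m : ℕ, Measurable fun ω => survival (stepLaw (P.map (Y 0)) (P.map (Z 0))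
        (Δ ω * (2 ^ m)⁻¹) (Γ ω * (2 ^ m)⁻¹)) (c * (2 ^ m)⁻¹) (m * 2 ^ m) u := fun m =>
      measurable_survival_stepLaw _ _ _ _ _ (by fun_prop) (by fun_prop)
    have hreal : ∀ m : ℕ, P.real (dyadicSurvival u c Z Y M L m) =
        ∫ ω, (survival (stepLaw (P.map (Y 0)) (P.map (Z 0))
          (Δ ω * (2 ^ m)⁻¹) (Γ ω * (2 ^ m)⁻¹)) (c * (2 ^ m)⁻¹) (m * 2 ^ m) u).toReal ∂P := by
      intro m
      rw [integral_toReal (hSm m).aemeasurable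
        ((hS1 m).mono fun ω h => h.trans_lt ENNReal.one_lt_top), measureReal_def, dyadicSurvival,
        measure_gridSurvival hmodel]
      simp
    simp_rw [hreal]
    refine tendsto_integral_of_dominated_convergence (fun _ => 1)
      (fun m => (hSm m).ennreal_toReal.aestronglyMeasurable) (integrable_const _)
      (fun m => ?_) ?_
    · filter_upwards [hS1 m] with ω hω
      rw [Real.norm_of_nonneg ENNReal.toReal_nonneg]
      exact ENNReal.toReal_le_of_le_ofReal zero_le_one (by simpa using hω)
    · filter_upwards [hmodel.pos_Δ, hmodel.pos_Γ] with ω h1 h2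
      rcases lt_or_ge (Γ ω / b - Δ ω / a) c with hω | hω
      · have hGω : G ω = phi b (R (Γ ω, Δ ω)) u := by
          simp [hG, condRuinProb_eq_phi hu (p := (Γ ω, Δ ω)) hω, hω]
        rw [hGω]
        exact tendsto_survival_of_isAdjustmentRoot hY hZ ha hb h1.le h2 hc (hroot _ _ h2 h1 hω) u
      · have hGω : G ω = 1 := by
          simp [hG, condRuinProb_eq_zero (p := (Γ ω, Δ ω)) hω, hω]
        rw [hGω, sub_self]
        exact tendsto_survival_of_le hY hZ ha hb h1.le h2 hc hω hu
  have heq := tendsto_nhds_unique (hmodel.tendsto_dyadicSurvival u c) hlim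
  rw [integral_sub (integrable_const _) hGint] at heq
  simp only [integral_const, probReal_univ, smul_eq_mul, mul_one] at heq
  linarith

end Model

end Ruin

-- Solving the adjustment equation.

section Root

variable {a b c γ δ : ℝ}

/-- Clearing denominators and completing the square gives a quadratic with discriminant `D > 0`. The
drift condition makes its roots have opposite signs, so only the larger one can lie in `(0, b)`. -/
lemma isAdjustmentRoot_iff_adjRate (ha : 0 < a) (hb : 0 < b) (hc : 0 < c) (hγ : 0 < γ)
    (hδ : 0 < δ) (h : γ / b - δ / a < c) (r : ℝ) :
    IsAdjustmentRoot a b c γ δ r ↔ r = adjRate a b c γ δ := by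
  have hdrift : a * γ < b * δ + a * b * c := by
    have := mul_lt_mul_of_pos_right h (mul_pos ha hb)
    field_simp at this
    linarith
  have hD : ((a + b) * c + δ) ^ 2 - 2 * ((a + b) * c - δ) * γ + γ ^ 2 =
      ((a + b) * c + δ - γ) ^ 2 + 4 * δ * γ := by ring
  set D := ((a + b) * c + δ) ^ 2 - 2 * ((a + b) * c - δ) * γ + γ ^ 2 with hDdef
  have hD0 : 0 < D := by rw [hD]; positivity
  have hsq : √D ^ 2 = D := Real.sq_sqrt hD0.le
  have hsD : 0 < √D := Real.sqrt_pos.2 hD0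
  have hquad : ∀ r, 0 < r → r < b → (c + δ / (a + r) = γ / (b - r) ↔
      (2 * c * r - (c * (b - a) - δ - γ)) ^ 2 = D) := by
    intro r h1 h2
    have h3 : a + r ≠ 0 := by positivity
    have h4 : b - r ≠ 0 := by linarith
    rw [add_div' _ _ _ h3, div_eq_div_iff h3 h4]
    constructor
    · intro e
      rw [hD]
      linear_combination (-4 * c) * e
    · intro e
      rw [hD] at e
      have : 4 * c * ((c * (a + r) + δ) * (b - r) - γ * (a + r)) = 0 := by linear_combination -e
      have := (mul_eq_zero.1 this).resolve_left (by positivity)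
      linarith
  -- The difference of the squares is `4 c (b δ + a b c - a γ)`, positive by the drift condition.
  have hlow : |c * (b - a) - δ - γ| < √D := by
    rw [← Real.sqrt_sq_eq_abs]
    refine Real.sqrt_lt_sqrt (sq_nonneg _) ?_
    rw [hD]
    nlinarith [mul_pos hc (sub_pos.2 hdrift)]
  obtain ⟨hlow1, hlow2⟩ := abs_lt.1 hlow
  rw [IsAdjustmentRoot, adjRate, ← hDdef,
    eq_div_iff (show 2 * c ≠ 0 by positivity)]
  constructor
  · rintro ⟨⟨h1, h2⟩, e⟩
    rw [hquad r h1 h2, ← hsq, sq_eq_sq_iff_eq_or_eq_neg] at e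
    rcases e with e | e
    · linarith
    · nlinarith [mul_pos hc h1]
  · intro e
    have h1 : 0 < r := by
      by_contra hr
      nlinarith
    -- This is `r < b` rewritten; the difference of the squares is `4 (a + b) c γ`.
    have hup : √D < (a + b) * c + δ + γ := by
      rw [Real.sqrt_lt' (by positivity), hD]
      nlinarith [mul_pos (mul_pos (add_pos ha hb) hc) hγ]
    have h2 : r < b := by
      by_contra hr
      nlinarith
    refine ⟨⟨h1, h2⟩, (hquad r h1 h2).2 ?_⟩
    rw [← hsq]
    congr 1
    linarith

/-- Without the premium rate the equation is linear once denominators are cleared. -/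
lemma isAdjustmentRoot_zero_iff (ha : 0 < a) (hb : 0 < b) (hγ : 0 < γ)
    (hδ : 0 < δ) (h : γ / b - δ / a < 0) (r : ℝ) :
    IsAdjustmentRoot a b 0 γ δ r ↔ r = (b * δ - a * γ) / (δ + γ) := by
  have hdrift : a * γ < b * δ := by
    have := mul_lt_mul_of_pos_right h (mul_pos ha hb)
    field_simp at this
    linarith
  have hs : 0 < δ + γ := by positivity
  rw [IsAdjustmentRoot, eq_div_iff hs.ne', zero_add]
  constructor
  · rintro ⟨⟨h1, h2⟩, e⟩
    have h3 : a + r ≠ 0 := by positivity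
    have h4 : b - r ≠ 0 := by linarith
    rw [div_eq_div_iff h3 h4] at e
    linarith
  · intro e
    have h1 : 0 < r := by
      by_contra hr
      nlinarith
    have h2 : r < b := by
      by_contra hr
      nlinarith [mul_pos hγ ha, mul_pos hγ hb]
    refine ⟨⟨h1, h2⟩, ?_⟩
    have h3 : a + r ≠ 0 := by positivity
    have h4 : b - r ≠ 0 := by linarith
    rw [div_eq_div_iff h3 h4]
    linarith

end Root

end RuinModel

end

theorem mainTheorem2 {Ω : Type*} [MeasurableSpace Ω] (P : Measure Ω) [IsProbabilityMeasure P]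
    (Z Y : ℕ → Ω → ℝ) (M L : ℝ≥0 → Ω → ℕ) (Δ Γ : Ω → ℝ)
    (hmodel : RuinModel.IsSurplusModel P Z Y M L Δ Γ)
    (a b : ℝ) (ha : 0 < a) (hb : 0 < b)
    (hY : P.map (Y 0) = expMeasure a) (hZ : P.map (Z 0) = expMeasure b)
    (c : ℝ) (hc : 0 ≤ c) (u : ℝ) (hu : 0 ≤ u) :
    NullMeasurableSet (RuinModel.ruin u c Z Y M L) P ∧
    (0 < c →
      (∀ γ δ : ℝ, 0 < γ → 0 < δ → γ / b - δ / a < c → ∀ r : ℝ,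
        RuinModel.IsAdjustmentRoot a b c γ δ r ↔ r = RuinModel.adjRate a b c γ δ) ∧
      IntegrableOn (RuinModel.ruinIntegrand a b c u) (Ioi 0 ×ˢ Ioi 0)
        (P.map (fun ω => (Γ ω, Δ ω))) ∧
      RuinModel.ruinProb P c Z Y M L u =
        (∫ p in Ioi 0 ×ˢ Ioi 0, RuinModel.ruinIntegrand a b c u p
          ∂(P.map (fun ω => (Γ ω, Δ ω)))) +
        P.real {ω | Γ ω / b - Δ ω / a ≥ c}) ∧
    (c = 0 →
      (∀ γ δ : ℝ, 0 < γ → 0 < δ → γ / b - δ / a < 0 → ∀ r : ℝ,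
        RuinModel.IsAdjustmentRoot a b 0 γ δ r ↔ r = (b * δ - a * γ) / (δ + γ)) ∧
      IntegrableOn (RuinModel.ruinIntegrandZero a b u) (Ioi 0 ×ˢ Ioi 0)
        (P.map (fun ω => (Γ ω, Δ ω))) ∧
      RuinModel.ruinProb P c Z Y M L u =
        (∫ p in Ioi 0 ×ˢ Ioi 0, RuinModel.ruinIntegrandZero a b u p
          ∂(P.map (fun ω => (Γ ω, Δ ω)))) +
        P.real {ω | Γ ω / b - Δ ω / a ≥ 0}) := by
  refine ⟨hmodel.nullMeasurableSet_ruin u c, fun hc0 => ?_, ?_⟩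
  · have hiff : ∀ γ δ : ℝ, 0 < γ → 0 < δ → γ / b - δ / a < c → ∀ r : ℝ,
        RuinModel.IsAdjustmentRoot a b c γ δ r ↔ r = RuinModel.adjRate a b c γ δ :=
      fun γ δ hγ hδ h => RuinModel.isAdjustmentRoot_iff_adjRate ha hb hc0 hγ hδ h
    have hR : Measurable fun p : ℝ × ℝ => RuinModel.adjRate a b c p.1 p.2 := by
      unfold RuinModel.adjRate
      fun_prop
    have hroot : ∀ γ δ, 0 < γ → 0 < δ → γ / b - δ / a < c →
        RuinModel.IsAdjustmentRoot a b c γ δ (RuinModel.adjRate a b c γ δ) :=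
      fun γ δ hγ hδ h => (hiff γ δ hγ hδ h _).2 rfl
    -- `ruinIntegrand` unfolds to `condRuinProb` with `adjRate` as the selected root.
    exact ⟨hiff, hmodel.integrableOn_condRuinProb hb hR hroot hu,
      hmodel.ruinProb_eq ha hb hY hZ hc hR hroot hu⟩
  · rintro rfl
    have hiff : ∀ γ δ : ℝ, 0 < γ → 0 < δ → γ / b - δ / a < 0 → ∀ r : ℝ,
        RuinModel.IsAdjustmentRoot a b 0 γ δ r ↔ r = (b * δ - a * γ) / (δ + γ) :=
      fun γ δ hγ hδ h => RuinModel.isAdjustmentRoot_zero_iff ha hb hγ hδ h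
    have hR : Measurable fun p : ℝ × ℝ => (b * p.2 - a * p.1) / (p.2 + p.1) := by fun_prop
    have hroot : ∀ γ δ : ℝ, 0 < γ → 0 < δ → γ / b - δ / a < 0 →
        RuinModel.IsAdjustmentRoot a b 0 γ δ ((b * δ - a * γ) / (δ + γ)) :=
      fun γ δ hγ hδ h => (hiff γ δ hγ hδ h _).2 rfl
    -- The stated prefactor is `1 - r / b` simplified, which uses `γ ≠ 0` and `δ + γ ≠ 0`; hence
    -- equality on the open quadrant.
    have hcongr : EqOn (RuinModel.condRuinProb a b 0 u
        fun p : ℝ × ℝ => (b * p.2 - a * p.1) / (p.2 + p.1))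
        (RuinModel.ruinIntegrandZero a b u) (Ioi 0 ×ˢ Ioi 0) := by
      rintro ⟨γ, δ⟩ ⟨hγ, hδ⟩
      rw [mem_Ioi] at hγ hδ
      dsimp only at hγ hδ
      have e : 1 - (b * δ - a * γ) / (δ + γ) / b = (1 + a / b) / (1 + δ / γ) := by
        field_simp
        ring
      simp only [RuinModel.condRuinProb, RuinModel.ruinIntegrandZero, e]
    have hms : MeasurableSet (Ioi (0 : ℝ) ×ˢ Ioi (0 : ℝ)) :=
      measurableSet_Ioi.prod measurableSet_Ioi
    refine ⟨hiff, (hmodel.integrableOn_condRuinProb hb hR hroot hu).congr_fun hcongr hms, ?_⟩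
    rw [← setIntegral_congr_fun hms hcongr]
    exact hmodel.ruinProb_eq ha hb hY hZ le_rfl hR hroot hu
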